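/- Let $q\in(0,1)$, $\theta\in\mathbb N=\{0,1,2,\dots\}$, $L\ge 1$, $\Omega_L=\{0,1,\dots,\theta\}^L$. For $x\in\Omega_L$ put $N(x)=\sum_{m=1}^L x_m$, $N^-_{i}(x)=\sum_{m=1}^{i}x_m$, $N^+_{i}(x)=\sum_{m=i}^{L}x_m$ (empty sums are $0$), and let $x^{i,j}$ be $x$ with one particle moved from site $i$ to site $j$. Write $\{a\}_b=\frac{1-b^a}{1-b}$, $[a]_q=\frac{q^a-q^{-a}}{q-q^{-1}}$, $[n]_q!=\prod_{k=1}^n[k]_q$, $\binom{\theta}{m}_q=\frac{[\theta]_q!}{[m]_q!\,[\theta-m]_q!}$ for $m\le\theta$, $(a;b)_m=\prod_{k=0}^{m-1}(1-ab^k)$, and $(a)_\infty=\prod_{k\ge 0}(1-aq^{2k})$. ASEP$(q,\theta)$ on $\{1,\dots,L\}$ with closed boundary is the continuous-time Markov process on $\Omega_L$ with generator $$[\mathcal Lf](x)=\sum_{i=1}^{L-1}\Big(q^{-2\theta+1}\{x_i\}_{q^2}\{\theta-x_{i+1}\}_{q^2}[f(x^{i,i+1})-f(x)]+q^{2\theta-1}\{x_{i+1}\}_{q^{-2}}\{\theta-x_i\}_{q^{-2}}[f(x^{i+1,i})-f(x)]\Big).$$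 For $c\in\mathbb N$ and $n,y\in\{0,\dots,c\}$ let $$K_n(q^{-y};p,c;q)={}_2\varphi_1\!\left(q^{-y},q^{-n};q^{-c};q,pq^{n+1}\right)=\sum_{k=0}^{\min(n,y)}\frac{(q^{-y};q)_k(q^{-n};q)_k}{(q^{-c};q)_k}\,\frac{(pq^{n+1})^k}{(q;q)_k}$$ be the $q$-Krawtchouk polynomials. Let $0<\alpha<q^{-1+(2L+1)\theta}$, and for $x,n\in\Omega_L$ let $$D_\alpha(x,n)=\prod_{i=1}^L K_{n_i}\big(q^{-2x_i};p_{i,\alpha}(x,n),\theta;q^2\big),\qquad p_{i,\alpha}(x,n)=\frac1\alpha\,q^{-2(N^-_{i-1}(x)-N^+_{i+1}(n))+\theta(2i-1)-1}.$$ Let $\mu_\alpha(x)=\prod_{i=1}^L\alpha^{x_i}\binom{\theta}{x_i}_q q^{-2\theta i x_i}$ and $$\omega_\alpha(x)=\frac{\mu_\alpha(x)}{\mathcal Z_\alpha}\,q^{N(x)(N(x)-1)}\big(\alpha q^{1+2N(x)-\theta(2L+1)}\big)_\infty,$$ $$\mathcal Z_\alpha=\sum_{x\in\Omega_L}\mu_\alpha(x)\,q^{N(x)(N(x)-1)}\big(\alpha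 q^{1+2N(x)-\theta(2L+1)}\big)_\infty,$$ $$g_{\alpha,-1}(x)=\frac{q^{2N(x)(N(x)-1)}}{\mathcal Z_\alpha^2}\big(\alpha q^{1+2N(x)-\theta(2L+1)}\big)_\infty\big(\alpha q^{1-2N(x)-\theta}\big)_\infty .$$ Theorem. (i) ASEP$(q,\theta)$ is self-dual with respect to $D_\alpha$: for any two copies $X,\widehat X$ of the process, all $x,n\in\Omega_L$ and all $t>0$, $$\mathbb E_x[D_\alpha(X_t,n)]=\widehat{\mathbb E}_n[D_\alpha(x,\widehat X_t)];$$ equivalently, with the transition probabilities $p_t=e^{t\mathcal L}$, $\sum_y p_t(x,y)D_\alpha(y,n)=\sum_y p_t(n,y)D_\alpha(x,y)$ for all $t\ge 0$. (ii) $\omega_\alpha$ is a strictly positive probability measure on $\Omega_L$, reversible for the process (it satisfies detailed balance), and the functions $D_\alpha(\cdot,n)$, $n\in\Omega_L$, are orthogonal with respect to it: for all $x,n\in\Omega_L$, $$\sum_{z\in\Omega_L}D_\alpha(z,x)\,D_\alpha(z,n)\,\omega_\alpha(z)=\delta_{x,n}\,\frac{g_{\alpha,-1}(x)}{\omega_\alpha(x)}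 .$$ -/

import Mathlib

open scoped NNReal
open MeasureTheory

noncomputable section

namespace ASEP

/-! ### `q`-calculus -/

/-- The number `{a}_b = (1 - b ^ a) / (1 - b)`; it is used with base `b = q ^ 2` and
with base `b = q ^ (-2)`. -/
def qNum (b : ℝ) (a : ℤ) : ℝ := (1 - b ^ a) / (1 - b)

/-- The symmetric `q`-number `[a]_q = (q ^ a - q ^ (-a)) / (q - q⁻¹)`. -/
def qBracket (q : ℝ) (a : ℕ) : ℝ := (q ^ (a : ℤ) - q ^ (-(a : ℤ))) / (q - q⁻¹)

/-- The `q`-factorial `[n]_q! = [n]_q [n-1]_q ⋯ [1]_q`. -/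
def qFactorial (q : ℝ) (n : ℕ) : ℝ := ∏ k ∈ Finset.range n, qBracket q (k + 1)

/-- The `q`-binomial coefficient, equal to `0` unless `m ≤ θ`. -/
def qBinom (q : ℝ) (θ m : ℕ) : ℝ :=
  if m ≤ θ then qFactorial q θ / (qFactorial q m * qFactorial q (θ - m)) else 0

/-- The finite `q`-shifted factorial `(a; b)_m`. -/
def qPoch (a b : ℝ) (m : ℕ) : ℝ := ∏ k ∈ Finset.range m, (1 - a * b ^ k)

/-- The infinite `q`-shifted factorial `(a; b)_∞`, used for `0 < b < 1`, where the product
converges. -/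
def qPochInf (a b : ℝ) : ℝ := ∏' k : ℕ, (1 - a * b ^ k)

/-- The basic hypergeometric series `₂φ₁(a, b; c; q, z)`. -/
def phi21 (a b c q z : ℝ) : ℝ :=
  ∑' k : ℕ, qPoch a q k * qPoch b q k / qPoch c q k * (z ^ k / qPoch q q k)

/-- The (quantum) `q`-Krawtchouk polynomial
`K_n(y; p, c; q) = ₂φ₁(y, q ^ (-n); q ^ (-c); q, p q ^ (n+1))`, used at `y = q ^ (-x)` with
`n, x ∈ {0, …, c}`. The series then terminates: its terms vanish for `k > min n x`, also for
`k > c`, where the numerator and the denominator `(q ^ (-c); q)_k` are both `0`. -/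
def qKrawtchouk (n : ℕ) (y p : ℝ) (c : ℕ) (q : ℝ) : ℝ :=
  phi21 y (q ^ (-(n : ℤ))) (q ^ (-(c : ℤ))) q (p * q ^ (n + 1))

/-! ### Configurations -/

/-- Particle configurations on `{1, …, L}` with at most `θ` particles per site. The site
`i ∈ {1, …, L}` is represented by the element of `Fin L` of value `i - 1`. -/
abbrev Config (L θ : ℕ) : Type := Fin L → Fin (θ + 1)

variable {L θ : ℕ}

/-- The configuration obtained from `x` by moving one particle from site `i` to site `j`.
It is meaningful for `i ≠ j`, `0 < x i` and `x j < θ`; in the generator it is multiplied by a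
rate that is zero in every other case. -/
def move (x : Config L θ) (i j : Fin L) : Config L θ := fun k =>
  if k = i then ⟨(x i : ℕ) - 1, by omega⟩
  else if k = j then ⟨min ((x j : ℕ) + 1) θ, by omega⟩
  else x k

/-- The number of particles strictly to the left of site `i`, that is `N⁻_{i-1}(x)`. -/
def leftMass (x : Config L θ) (i : Fin L) : ℕ := ∑ m ∈ Finset.Iio i, (x m : ℕ)

/-- The number of particles strictly to the right of site `i`, that is `N⁺_{i+1}(x)`. -/
def rightMass (x : Config L θ) (i : Fin L) : ℕ := ∑ m ∈ Finset.Ioi i, (x m : ℕ)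

/-- The total number of particles `N(x)`. -/
def mass (x : Config L θ) : ℕ := ∑ m, (x m : ℕ)

/-! ### The generator -/

/-- The action of the generator on the bond from site `i` to its right neighbour `j`. -/
def bondGenerator (q : ℝ) (i j : Fin L) : (Config L θ → ℝ) →ₗ[ℝ] (Config L θ → ℝ) where
  toFun f x :=
    q ^ (-2 * (θ : ℤ) + 1) * qNum (q ^ (2 : ℤ)) (x i : ℕ)
        * qNum (q ^ (2 : ℤ)) ((θ : ℤ) - (x j : ℕ)) * (f (move x i j) - f x)
      + q ^ (2 * (θ : ℤ) - 1) * qNum (q ^ (-2 : ℤ)) (x j : ℕ)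
        * qNum (q ^ (-2 : ℤ)) ((θ : ℤ) - (x i : ℕ)) * (f (move x j i) - f x)
  map_add' f g := by
    funext x
    simp only [Pi.add_apply]
    ring
  map_smul' c f := by
    funext x
    simp only [Pi.smul_apply, smul_eq_mul, RingHom.id_apply]
    ring

/-- The generator of `ASEP(q, θ)` on `{1, …, L}` with closed boundary conditions: the sum of
the bond generators over all pairs of neighbouring sites. -/
def generator (L θ : ℕ) (q : ℝ) : (Config L θ → ℝ) →ₗ[ℝ] (Config L θ → ℝ) :=
  ∑ i : Fin L, ∑ j : Fin L, if (j : ℕ) = (i : ℕ) + 1 then bondGenerator q i j else 0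

/-! ### Markov processes on a finite state space, and duality -/

/-- The transition function `p_t(x, y) = (e ^ {t G} 1_{y})(x)` generated by an operator `G` on
the functions on a finite set. -/
def transition {S : Type*} [Fintype S] [DecidableEq S] (G : (S → ℝ) →ₗ[ℝ] (S → ℝ))
    (t : ℝ≥0) : Matrix S S ℝ :=
  NormedSpace.exp ((t : ℝ) • LinearMap.toMatrix' G)

/-- `X`, under the laws `P x` (the process started at `x`), is a continuous-time Markov process
on the finite state space `S` with generator `G`: under `P x` it starts at `x`, and given its past
up to time `s` (the `σ`-algebra generated by `X u`, `u ≤ s`) and `X s = y`, it is at `z` at time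
`s + t` with probability `p_t(y, z)`. -/
structure IsMarkovProcess {S : Type*} [Fintype S] [DecidableEq S] [MeasurableSpace S]
    {Ω : Type*} [MeasurableSpace Ω] (G : (S → ℝ) →ₗ[ℝ] (S → ℝ))
    (P : S → Measure Ω) (X : ℝ≥0 → Ω → S) : Prop where
  isProbabilityMeasure : ∀ x, IsProbabilityMeasure (P x)
  measurable : ∀ t, Measurable (X t)
  start : ∀ x, ∀ᵐ ω ∂(P x), X 0 ω = x
  markov : ∀ (x : S) (s t : ℝ≥0) (A : Set Ω),
    MeasurableSet[⨆ u ∈ Set.Iic s, MeasurableSpace.comap (X u) inferInstance] A →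
    ∀ y z : S, (P x).real (A ∩ {ω | X s ω = y} ∩ {ω | X (s + t) ω = z})
      = (P x).real (A ∩ {ω | X s ω = y}) * transition G t y z

/-- Two Markov processes, given by families of laws indexed by the starting point, are dual
with respect to `D`: `𝔼_x[D(X_t, x')] = 𝔼_{x'}[D(x, X'_t)]` for all `x`, `x'` and `t > 0`. -/
def AreDual {S S' Ω Ω' : Type*} [MeasurableSpace Ω] [MeasurableSpace Ω']
    (P : S → Measure Ω) (X : ℝ≥0 → Ω → S) (P' : S' → Measure Ω') (X' : ℝ≥0 → Ω' → S')
    (D : S → S' → ℝ) : Prop :=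
  ∀ (x : S) (x' : S') (t : ℝ≥0), 0 < t →
    ∫ ω, D (X t ω) x' ∂(P x) = ∫ ω, D x (X' t ω) ∂(P' x')

/-! ### The reversible measures and the duality functions -/

/-- The reversible product weight `μ_α`. -/
def mu (q α : ℝ) (x : Config L θ) : ℝ :=
  ∏ i : Fin L, α ^ (x i : ℕ) * qBinom q θ (x i)
    * q ^ (-2 * (θ : ℤ) * ((i : ℕ) + 1) * (x i : ℕ))

/-- The modified weight `ω_α` before normalization. -/
def omegaWeight (q α : ℝ) (x : Config L θ) : ℝ :=
  mu q α x * q ^ ((mass x : ℤ) * ((mass x : ℤ) - 1))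
    * qPochInf (α * q ^ (1 + 2 * (mass x : ℤ) - (θ : ℤ) * (2 * (L : ℤ) + 1))) (q ^ 2)

/-- The normalizing constant of `ω_α`. -/
def partition (L θ : ℕ) (q α : ℝ) : ℝ := ∑ x : Config L θ, omegaWeight q α x

/-- The modified reversible measure `ω_α`. -/
def omega (q α : ℝ) (x : Config L θ) : ℝ := omegaWeight q α x / partition L θ q α

/-- The function `g_{α,-1}`. -/
def g (q α : ℝ) (x : Config L θ) : ℝ :=
  q ^ (2 * (mass x : ℤ) * ((mass x : ℤ) - 1)) / partition L θ q α ^ 2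
    * qPochInf (α * q ^ (1 + 2 * (mass x : ℤ) - (θ : ℤ) * (2 * (L : ℤ) + 1))) (q ^ 2)
    * qPochInf (α * q ^ (1 - 2 * (mass x : ℤ) - (θ : ℤ))) (q ^ 2)

/-- The parameter
`p_{i,α}(x, n) = α⁻¹ q ^ (-2 (N⁻_{i-1}(x) - N⁺_{i+1}(n)) + θ (2 i - 1) - 1)`. -/
def param (q α : ℝ) (x n : Config L θ) (i : Fin L) : ℝ :=
  1 / α * q ^ (-2 * ((leftMass x i : ℤ) - (rightMass n i : ℤ))
    + (θ : ℤ) * (2 * ((i : ℕ) + 1) - 1) - 1)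

/-- The nested product of `q`-Krawtchouk polynomials
`D_α(x, n) = ∏ i, K_{n_i}(q ^ (-2 x_i); p_{i,α}(x, n), θ; q ^ 2)`. -/
def dualityFunction (q α : ℝ) (x n : Config L θ) : ℝ :=
  ∏ i : Fin L,
    qKrawtchouk (n i) (q ^ (-2 * ((x i : ℕ) : ℤ))) (param q α x n i) θ (q ^ 2)

end ASEP

end

noncomputable section

namespace ASEP

variable {L θ : ℕ}

/-! ### The terminating series `₂φ₁` -/

/-! Put b = q², C = b^(-θ), A = b^(-x), B = b^(-n). Each factor of D_α is a terminating series φ(A,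
B; z), symmetric in A and B. The identities for these series follow from two facts: the raising
relation `truncPhi_raise` and the second-order q-difference equation in z, `truncPhi_qdiff`.

Self-duality reduces to one bond. The argument at site k depends on the x-particles strictly left of
k and on the n-particles from k onwards, so a jump across (i, i+1) changes the argument at i+1 only,
and that argument is w = z A₁ B₁ / C, with z the argument at i. Written through values of the two
series at shifted arguments, the bond operator acting on x and the one acting on n differ by a
multiple of the q-difference equation of the second series (`bondAction_comm`). The relation passes
to the semigroup through the matrix exponential (`transition_duality`).

Reversibility: μ_α satisfies detailed balance on each bond (`muFactor_rate`), and ω_α / μ_α depends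
only on the conserved number of particles.

Orthogonality is an induction on L that removes the last site. Given the other sites, that site
carries one-site Krawtchouk polynomials and their weight, with a fugacity depending on the mass to
its left; summing it out leaves the same problem on L sites with α replaced by α q^(-2c). At one
site, polynomials of different degree are eigenfunctions of one symmetric second-order operator with
different eigenvalues, and the norms follow from the three-term recurrence, starting from the total
mass `sum_siteWeight` (`site_orthogonality`). -/

theorem qPoch_zero (a b : ℝ) : qPoch a b 0 = 1 := by simp [qPoch]

theorem qPoch_succ (a b : ℝ) (m : ℕ) : qPoch a b (m + 1) = qPoch a b m * (1 - a * b ^ m) := by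
  simp [qPoch, Finset.prod_range_succ]

theorem one_sub_mul_qPoch (a b : ℝ) (m : ℕ) :
    (1 - a) * qPoch (a * b) b m = qPoch a b m * (1 - a * b ^ m) := by
  induction m with
  | zero => simp [qPoch_zero]
  | succ m ih => rw [qPoch_succ, ← mul_assoc, ih, qPoch_succ]; ring

theorem qPoch_ne_zero {a b : ℝ} {m : ℕ} (h : ∀ k < m, a * b ^ k ≠ 1) : qPoch a b m ≠ 0 := by
  rw [qPoch, Finset.prod_ne_zero_iff]
  intro k hk
  exact sub_ne_zero.2 (h k (Finset.mem_range.1 hk)).symm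

theorem qPoch_eq_zero {a b : ℝ} {m k : ℕ} (hk : k < m) (h : a * b ^ k = 1) : qPoch a b m = 0 := by
  rw [qPoch, Finset.prod_eq_zero_iff]
  exact ⟨k, Finset.mem_range.2 hk, by simp [h]⟩

/-- The series `₂φ₁(A, B; b ^ (-θ); b, z)` truncated after the term of index `θ`. -/
def truncPhi (b : ℝ) (θ : ℕ) (A B z : ℝ) : ℝ :=
  ∑ k ∈ Finset.range (θ + 1),
    qPoch A b k * qPoch B b k / qPoch (b ^ (-(θ : ℤ))) b k * (z ^ k / qPoch b b k)

theorem truncPhi_comm (b : ℝ) (θ : ℕ) (A B z : ℝ) : truncPhi b θ A B z = truncPhi b θ B A z := by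
  simp only [truncPhi, mul_comm (qPoch A b _)]

theorem truncPhi_one_left (b : ℝ) (θ : ℕ) (B z : ℝ) : truncPhi b θ 1 B z = 1 := by
  rw [truncPhi, Finset.sum_range_succ', Finset.sum_eq_zero]
  · simp [qPoch_zero]
  · intro k _
    rw [qPoch_eq_zero (k := 0) (Nat.succ_pos k) (by simp)]
    simp

/-- Raising the first parameter. -/
theorem truncPhi_raise (b : ℝ) (θ : ℕ) (A B z : ℝ) :
    (1 - A) * truncPhi b θ (A * b) B z = truncPhi b θ A B z - A * truncPhi b θ A B (b * z) := by
  simp only [truncPhi, Finset.mul_sum, ← Finset.sum_sub_distrib]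
  refine Finset.sum_congr rfl fun k _ => ?_
  rw [mul_pow]
  linear_combination (qPoch B b k / qPoch (b ^ (-(θ : ℤ))) b k * (z ^ k / qPoch b b k))
    * one_sub_mul_qPoch A b k

theorem qPoch_self_ne_zero {b : ℝ} (hb0 : 0 < b) (hb1 : b < 1) (k : ℕ) : qPoch b b k ≠ 0 := by
  refine qPoch_ne_zero fun j _ => ?_
  rw [← pow_succ']
  exact (pow_lt_one₀ hb0.le hb1 j.succ_ne_zero).ne

theorem zpow_neg_mul_pow_ne_one {b : ℝ} (hb0 : 0 < b) (hb1 : b < 1) {θ k : ℕ} (hk : k ≠ θ) :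
    b ^ (-(θ : ℤ)) * b ^ k ≠ 1 := by
  rw [← zpow_natCast b k, ← zpow_add₀ hb0.ne', ← zpow_zero b]
  intro h
  have := zpow_right_injective₀ hb0 hb1.ne h
  omega

theorem qPoch_zpow_neg_ne_zero {b : ℝ} (hb0 : 0 < b) (hb1 : b < 1) {θ k : ℕ} (hk : k ≤ θ) :
    qPoch (b ^ (-(θ : ℤ))) b k ≠ 0 :=
  qPoch_ne_zero fun j hj => zpow_neg_mul_pow_ne_one hb0 hb1 (by omega)

/-- The `q`-difference equation of the truncated series, valid when the series terminates by
itself. -/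
theorem truncPhi_qdiff {b : ℝ} (hb0 : 0 < b) (hb1 : b < 1) (θ : ℕ) (A B z : ℝ)
    (h : qPoch A b (θ + 1) * qPoch B b (θ + 1) = 0) :
    (1 - z) * truncPhi b θ A B z
      - (1 + b ^ (-(θ : ℤ)) / b - z * (A + B)) * truncPhi b θ A B (b * z)
      + (b ^ (-(θ : ℤ)) / b - z * A * B) * truncPhi b θ A B (b * (b * z)) = 0 := by
  set C := b ^ (-(θ : ℤ)) with hC
  let e : ℕ → ℝ := fun k => qPoch A b k * qPoch B b k / qPoch C b k * (z ^ k / qPoch b b k)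
  -- Replacing z by bz multiplies the k-th term by b^k. Sorting the equation by explicit factors of
  -- z turns its left side into the sum of G - H, and the ratio of consecutive terms of the series
  -- says G (k + 1) = H k, so the sum telescopes.
  let G : ℕ → ℝ := fun k => e k * ((1 - b ^ k) * (1 - C / b * b ^ k))
  let H : ℕ → ℝ := fun k => z * e k * ((1 - A * b ^ k) * (1 - B * b ^ k))
  have hGH : ∀ k < θ, G (k + 1) = H k := by
    intro k hk
    have h1 := qPoch_self_ne_zero hb0 hb1 (k + 1)
    have h2 := qPoch_zpow_neg_ne_zero hb0 hb1 (show k + 1 ≤ θ by omega)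
    rw [← hC] at h2
    simp only [G, H, e]
    rw [qPoch_succ] at h1 h2
    simp only [qPoch_succ]
    have h3 := left_ne_zero_of_mul h1
    have h4 := right_ne_zero_of_mul h1
    have h5 := left_ne_zero_of_mul h2
    have h6 := right_ne_zero_of_mul h2
    have h7 : C / b * b ^ (k + 1) = C * b ^ k := by field_simp; ring
    have h8 : b ^ (k + 1) = b * b ^ k := pow_succ' b k
    rw [h7, h8, pow_succ z]
    generalize b ^ k = P at h4 h6 ⊢
    rw [div_mul_div_comm, div_mul_eq_mul_div, div_mul_div_comm, mul_div_assoc', div_mul_eq_mul_div,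
      div_eq_div_iff (mul_ne_zero (mul_ne_zero h5 h6) (mul_ne_zero h3 h4))
        (mul_ne_zero h5 h3)]
    ring
  have hG0 : G 0 = 0 := by simp [G]
  -- The upper boundary term carries the factors of index θ, completing (A; b)_(θ+1) (B; b)_(θ+1);
  -- this is where termination enters.
  have hHθ : H θ = 0 := by
    simp only [H, e]
    rw [qPoch_succ, qPoch_succ] at h
    have : qPoch A b θ * qPoch B b θ * ((1 - A * b ^ θ) * (1 - B * b ^ θ)) = 0 := by
      linear_combination h
    calc _ = z * (qPoch A b θ * qPoch B b θ * ((1 - A * b ^ θ) * (1 - B * b ^ θ)))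
          / qPoch C b θ * (z ^ θ / qPoch b b θ) := by ring
      _ = 0 := by rw [this]; simp
  have key : ∑ k ∈ Finset.range (θ + 1), (G k - H k) = 0 := by
    rw [Finset.sum_sub_distrib, Finset.sum_range_succ' G, Finset.sum_range_succ H, hG0, hHθ,
      Finset.sum_congr rfl fun k hk => hGH k (Finset.mem_range.1 hk)]
    ring
  rw [← key]
  simp only [truncPhi, Finset.mul_sum, ← Finset.sum_sub_distrib, ← Finset.sum_add_distrib, ← hC]
  refine Finset.sum_congr rfl fun k _ => ?_
  simp only [G, H, e, mul_pow]
  ring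

/-- Lowering the first parameter, with the argument multiplied by `b`. -/
theorem truncPhi_lower_shift {b : ℝ} (hb0 : 0 < b) (hb1 : b < 1) (θ : ℕ) {A B z : ℝ} (hA : A ≠ 0)
    (hAb : A ≠ b) (hB : qPoch B b (θ + 1) = 0) :
    (1 - b ^ (-(θ : ℤ)) / A) * truncPhi b θ (A / b) B (b * z)
      = (1 - z) * truncPhi b θ A B z
        - (b ^ (-(θ : ℤ)) / A - z * B) * truncPhi b θ A B (b * z) := by
  have hb := hb0.ne'
  have hne : 1 - A / b ≠ 0 := by
    rw [sub_ne_zero, ne_comm, Ne, div_eq_one_iff_eq hb]; exact hAb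
  -- Raising from A / b expresses the series at A through the series at A / b with arguments z, bz
  -- and b²z; the q-difference equation at A / b links these three. Multiplying by 1 - A / b makes
  -- the relation applicable, and A ≠ b allows cancelling it.
  have hr := fun z => truncPhi_raise b θ (A / b) B z
  rw [div_mul_cancel₀ A hb] at hr
  have hq := truncPhi_qdiff hb0 hb1 θ (A / b) B z (by rw [hB, mul_zero])
  refine mul_left_cancel₀ hne ?_
  have e1 : (1 - A / b) * ((1 - z) * truncPhi b θ A B z
        - (b ^ (-(θ : ℤ)) / A - z * B) * truncPhi b θ A B (b * z))
      = (1 - z) * ((1 - A / b) * truncPhi b θ A B z)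
        - (b ^ (-(θ : ℤ)) / A - z * B) * ((1 - A / b) * truncPhi b θ A B (b * z)) := by ring
  rw [e1, hr, hr]
  field_simp at hq ⊢
  linear_combination -A * hq

/-- Lowering the first parameter. -/
theorem truncPhi_lower {b : ℝ} (hb0 : 0 < b) (hb1 : b < 1) (θ : ℕ) {A B z : ℝ} (hA : A ≠ 0)
    (hAb : A ≠ b) (hB : qPoch B b (θ + 1) = 0) :
    b / A * ((1 - b ^ (-(θ : ℤ)) / A) * truncPhi b θ (A / b) B z)
      = (b / A + b ^ (-(θ : ℤ)) / A - b * b ^ (-(θ : ℤ)) / A ^ 2 - z) * truncPhi b θ A B z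
        - (b ^ (-(θ : ℤ)) / A - z * B) * truncPhi b θ A B (b * z) := by
  have hb := hb0.ne'
  have hne : 1 - A / b ≠ 0 := by
    rw [sub_ne_zero, ne_comm, Ne, div_eq_one_iff_eq hb]; exact hAb
  have hr := fun z => truncPhi_raise b θ (A / b) B z
  rw [div_mul_cancel₀ A hb] at hr
  have hq := truncPhi_qdiff hb0 hb1 θ (A / b) B z (by rw [hB, mul_zero])
  refine mul_left_cancel₀ hne ?_
  have e1 : (1 - A / b) * ((b / A + b ^ (-(θ : ℤ)) / A - b * b ^ (-(θ : ℤ)) / A ^ 2 - z)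
        * truncPhi b θ A B z - (b ^ (-(θ : ℤ)) / A - z * B) * truncPhi b θ A B (b * z))
      = (b / A + b ^ (-(θ : ℤ)) / A - b * b ^ (-(θ : ℤ)) / A ^ 2 - z)
          * ((1 - A / b) * truncPhi b θ A B z)
        - (b ^ (-(θ : ℤ)) / A - z * B) * ((1 - A / b) * truncPhi b θ A B (b * z)) := by ring
  rw [e1, hr, hr]
  field_simp at hq ⊢
  linear_combination -A^2 * hq

/-! ### Two-site duality. -/

/-- The bond generator, up to a constant factor, acting on a product of two series. The particle
numbers enter through `A₁ = b ^ (-x₁)`, `A₂ = b ^ (-x₂)`. -/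
def bondAction (b : ℝ) (θ : ℕ) (A₁ A₂ B₁ B₂ z w : ℝ) : ℝ :=
  A₂ / A₁ * (1 - A₁) * (1 - b ^ (-(θ : ℤ)) / A₂)
      * (truncPhi b θ (A₁ * b) B₁ z * truncPhi b θ (A₂ / b) B₂ (b * w)
        - truncPhi b θ A₁ B₁ z * truncPhi b θ A₂ B₂ w)
    + b / b ^ (-(θ : ℤ)) * (1 - A₂) * (1 - b ^ (-(θ : ℤ)) / A₁)
      * (truncPhi b θ (A₁ / b) B₁ z * truncPhi b θ (A₂ * b) B₂ (w / b)
        - truncPhi b θ A₁ B₁ z * truncPhi b θ A₂ B₂ w)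

theorem bondAction_eq {b : ℝ} (hb0 : 0 < b) (hb1 : b < 1) (θ : ℕ) {A₁ A₂ B₁ B₂ z w : ℝ}
    (hA₁ : A₁ ≠ 0) (hA₂ : A₂ ≠ 0) (hA₁b : A₁ ≠ b) (hA₂b : A₂ ≠ b)
    (hB₁ : qPoch B₁ b (θ + 1) = 0) (hB₂ : qPoch B₂ b (θ + 1) = 0) :
    bondAction b θ A₁ A₂ B₁ B₂ z w =
      A₂ / A₁ * ((truncPhi b θ A₁ B₁ z - A₁ * truncPhi b θ A₁ B₁ (b * z))
        * ((1 - w) * truncPhi b θ A₂ B₂ w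
          - (b ^ (-(θ : ℤ)) / A₂ - w * B₂) * truncPhi b θ A₂ B₂ (b * w))
        - (1 - A₁) * (1 - b ^ (-(θ : ℤ)) / A₂) * (truncPhi b θ A₁ B₁ z * truncPhi b θ A₂ B₂ w))
      + b / b ^ (-(θ : ℤ)) * (A₁ / b
        * ((b / A₁ + b ^ (-(θ : ℤ)) / A₁ - b * b ^ (-(θ : ℤ)) / A₁ ^ 2 - z)
            * truncPhi b θ A₁ B₁ z
          - (b ^ (-(θ : ℤ)) / A₁ - z * B₁) * truncPhi b θ A₁ B₁ (b * z))
        * (truncPhi b θ A₂ B₂ (w / b) - A₂ * truncPhi b θ A₂ B₂ w)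
        - (1 - A₂) * (1 - b ^ (-(θ : ℤ)) / A₁)
          * (truncPhi b θ A₁ B₁ z * truncPhi b θ A₂ B₂ w)) := by
  have hb := hb0.ne'
  rw [← truncPhi_raise, ← truncPhi_lower_shift hb0 hb1 θ hA₂ hA₂b hB₂,
    ← truncPhi_lower hb0 hb1 θ hA₁ hA₁b hB₁]
  have h := truncPhi_raise b θ A₂ B₂ (w / b)
  rw [mul_div_cancel₀ w hb] at h
  rw [← h, bondAction]
  have : A₁ / b * (b / A₁ * ((1 - b ^ (-(θ : ℤ)) / A₁) * truncPhi b θ (A₁ / b) B₁ z))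
    = (1 - b ^ (-(θ : ℤ)) / A₁) * truncPhi b θ (A₁ / b) B₁ z := by field_simp
  rw [this]
  ring

/-- The two-site self-duality relation. -/
theorem bondAction_comm {b : ℝ} (hb0 : 0 < b) (hb1 : b < 1) (θ : ℕ) {A₁ A₂ B₁ B₂ z w : ℝ}
    (hA₁0 : A₁ ≠ 0) (hA₂0 : A₂ ≠ 0) (hA₁b : A₁ ≠ b) (hA₂b : A₂ ≠ b)
    (hB₁0 : B₁ ≠ 0) (hB₂0 : B₂ ≠ 0) (hB₁b : B₁ ≠ b) (hB₂b : B₂ ≠ b)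
    (hA₁ : qPoch A₁ b (θ + 1) = 0) (hA₂ : qPoch A₂ b (θ + 1) = 0)
    (hB₁ : qPoch B₁ b (θ + 1) = 0) (hB₂ : qPoch B₂ b (θ + 1) = 0)
    (hw : w = z * A₁ * B₁ / b ^ (-(θ : ℤ))) :
    bondAction b θ A₁ A₂ B₁ B₂ z w = bondAction b θ B₁ B₂ A₁ A₂ z w := by
  have hb := hb0.ne'
  rw [bondAction_eq hb0 hb1 θ hA₁0 hA₂0 hA₁b hA₂b hB₁ hB₂,
    bondAction_eq hb0 hb1 θ hB₁0 hB₂0 hB₁b hB₂b hA₁ hA₂]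
  simp only [truncPhi_comm b θ B₁ A₁, truncPhi_comm b θ B₂ A₂]
  have hq := truncPhi_qdiff hb0 hb1 θ A₂ B₂ (w / b) (by rw [hB₂, mul_zero])
  rw [mul_div_cancel₀ w hb] at hq
  have hC : b ^ (-(θ : ℤ)) ≠ 0 := zpow_ne_zero _ hb
  generalize truncPhi b θ A₂ B₂ (w / b) = gm at *
  generalize truncPhi b θ A₂ B₂ w = g at *
  generalize truncPhi b θ A₂ B₂ (b * w) = g1 at *
  generalize truncPhi b θ A₁ B₁ z = f at *
  generalize truncPhi b θ A₁ B₁ (b * z) = f1 at *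
  generalize b ^ (-(θ : ℤ)) = C at *
  subst hw
  -- Both sides are now bilinear in (f, f1) and (gm, g, g1). In their difference the terms with f1
  -- cancel, and what remains is this multiple of the q-difference equation of the second series at
  -- w / b.
  refine sub_eq_zero.1 (Eq.trans ?_ ((congrArg (f * (A₁ - B₁) * b / (A₁ * B₁) * ·) hq).trans
    (mul_zero _)))
  field_simp
  ring

/-! ### One-site orthogonality -/

/-- Supplies the hypothesis A ≠ b of the lowering relations: A = b would mean -1 particles. -/
theorem zpow_neg_ne_self {b : ℝ} (hb0 : 0 < b) (hb1 : b < 1) (x : ℕ) : b ^ (-(x : ℤ)) ≠ b := by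
  intro h
  have := zpow_right_injective₀ hb0 hb1.ne (a₁ := -(x : ℤ)) (a₂ := 1) (by simpa using h)
  omega

theorem qPoch_zpow_neg_eq_zero {b : ℝ} (hb0 : 0 < b) {θ n : ℕ} (hn : n ≤ θ) :
    qPoch (b ^ (-(n : ℤ))) b (θ + 1) = 0 := by
  refine qPoch_eq_zero (k := n) (by omega) ?_
  rw [zpow_neg, zpow_natCast, inv_mul_cancel₀ (pow_ne_zero _ hb0.ne')]

theorem zpow_neg_succ {b : ℝ} (hb : b ≠ 0) (x : ℕ) :
    b ^ (-((x + 1 : ℕ) : ℤ)) = b ^ (-(x : ℤ)) / b := by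
  rw [div_eq_mul_inv, ← zpow_sub_one₀ hb]; congr 1; push_cast; ring

/-- Second-order equation in the first parameter. -/
theorem truncPhi_eigen {b : ℝ} (hb0 : 0 < b) (hb1 : b < 1) (θ : ℕ) {A B z p : ℝ} (hA : A ≠ 0)
    (hAb : A ≠ b) (hB : qPoch B b (θ + 1) = 0) (hp : z * B = p) :
    z * truncPhi b θ A B z =
      (b + b ^ (-(θ : ℤ)) - b * b ^ (-(θ : ℤ)) / A - b ^ (-(θ : ℤ)) / A + p) / A
          * truncPhi b θ A B z
        - b * (1 - b ^ (-(θ : ℤ)) / A) / A * truncPhi b θ (A / b) B z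
        - (p - b ^ (-(θ : ℤ)) / A) * (1 - A) / A * truncPhi b θ (A * b) B z := by
  -- Eliminating the value at bz between raising and lowering leaves coefficients that involve z and
  -- B only through z B = p, apart from the z on the left. With p fixed, z is therefore the
  -- eigenvalue.
  have h1 := truncPhi_raise b θ A B z
  have h2 := truncPhi_lower hb0 hb1 θ (z := z) hA hAb hB
  subst hp
  field_simp at h1 h2 ⊢
  linear_combination h2 + (z * B * A - b ^ (-(θ : ℤ))) * h1

/-- Three-term recurrence in the second parameter. -/
theorem truncPhi_recurrence {b : ℝ} (hb0 : 0 < b) (hb1 : b < 1) (θ : ℕ) {A B z : ℝ} (hB : B ≠ 0)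
    (hBb : B ≠ b) (hA : qPoch A b (θ + 1) = 0) :
    z / B * (A * truncPhi b θ A B z) =
      (1 - b ^ (-(θ : ℤ)) / B) * truncPhi b θ A (B / b) (b * z)
        - b / B * (1 - z / b) * (1 - B) * truncPhi b θ A (B * b) (z / b)
        + ((b + b ^ (-(θ : ℤ))) / B - b - 1 + z) * truncPhi b θ A B z := by
  have hb := hb0.ne'
  -- B and the argument move oppositely, so their product stays fixed. The values at z / b and bz
  -- produced by raising and lowering in B are eliminated with the q-difference equation at z / b.
  have h1 := truncPhi_raise b θ B A (z / b)
  have h2 := truncPhi_lower_shift hb0 hb1 θ (z := z) hB hBb hA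
  have h3 := truncPhi_qdiff hb0 hb1 θ A B (z / b) (by rw [hA, zero_mul])
  simp only [truncPhi_comm b θ _ A, mul_div_cancel₀ z hb] at h1 h2 h3
  have e : b / B * (1 - z / b) * (1 - B) * truncPhi b θ A (B * b) (z / b)
      = b / B * (1 - z / b) * ((1 - B) * truncPhi b θ A (B * b) (z / b)) := by ring
  rw [e, h1, h2]
  field_simp at h3 ⊢
  linear_combination h3

/-- Solutions of a second-order equation that is symmetric with respect to `w` and have different
eigenvalues are orthogonal. -/
theorem sum_mul_eq_zero_of_eigen {θ : ℕ} {w E U V f f' fu fu' fd fd' : ℕ → ℝ} {z z' : ℝ}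
    (hz : z ≠ z')
    (hf : ∀ x ≤ θ, z * f x = E x * f x - U x * fu x - V x * fd x)
    (hf' : ∀ x ≤ θ, z' * f' x = E x * f' x - U x * fu' x - V x * fd' x)
    (hu : ∀ x, fu x = f (x + 1)) (hu' : ∀ x, fu' x = f' (x + 1))
    (hd : ∀ x, fd (x + 1) = f x) (hd' : ∀ x, fd' (x + 1) = f' x)
    (hV : V 0 = 0) (hw0 : w (θ + 1) = 0)
    (hw : ∀ x ≤ θ, w x * U x = w (x + 1) * V (x + 1)) :
    ∑ x ∈ Finset.range (θ + 1), w x * (f x * f' x) = 0 := by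
  -- Discrete Green identity: T is the weighted Casoratian. The value fd 0 is unconstrained, since V
  -- 0 = 0 removes it.
  let T : ℕ → ℝ := fun x => w x * V x * (f x * fd' x - f' x * fd x)
  have h : (z - z') * ∑ x ∈ Finset.range (θ + 1), w x * (f x * f' x) = T 0 - T (θ + 1) := by
    rw [← Finset.sum_range_sub', Finset.mul_sum]
    refine Finset.sum_congr rfl fun x hx => ?_
    have hx := Nat.lt_succ_iff.1 (Finset.mem_range.1 hx)
    simp only [T, ← hw x hx, hd, hd', ← hu, ← hu']
    linear_combination w x * f' x * hf x hx - w x * f x * hf' x hx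
  rw [show T 0 = 0 by simp [T, hV], show T (θ + 1) = 0 by simp [T, hw0], sub_zero] at h
  exact (mul_eq_zero.1 h).resolve_left (sub_ne_zero.2 hz)

/-! ### Infinite q-shifted factorials. -/

theorem qPochInf_multipliable (a : ℝ) {b : ℝ} (hb0 : 0 < b) (hb1 : b < 1) :
    Multipliable fun k : ℕ => 1 - a * b ^ k := by
  have : Summable fun k : ℕ => -(a * b ^ k) :=
    ((summable_geometric_of_lt_one hb0.le hb1).mul_left a).neg
  simpa [sub_eq_add_neg] using Real.multipliable_one_add_of_summable this

theorem qPochInf_eq (a : ℝ) {b : ℝ} (hb0 : 0 < b) (hb1 : b < 1) :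
    qPochInf a b = (1 - a) * qPochInf (a * b) b := by
  have h : (fun k : ℕ => 1 - a * b ^ (k + 1)) = fun k : ℕ => 1 - a * b * b ^ k := by
    funext k; rw [pow_succ']; ring
  rw [qPochInf, tprod_eq_zero_mul' (by rw [h]; exact qPochInf_multipliable _ hb0 hb1), h]
  simp [qPochInf]

theorem qPochInf_pos {a b : ℝ} (hb0 : 0 < b) (hb1 : b < 1) (ha : a < 1) : 0 < qPochInf a b := by
  have hpos : ∀ k : ℕ, 0 < 1 - a * b ^ k := by
    intro k
    have h0 := pow_pos hb0 k
    have h1 := pow_le_one₀ (n := k) hb0.le hb1.le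
    nlinarith
  have : Summable fun k : ℕ => -(a * b ^ k) :=
    ((summable_geometric_of_lt_one hb0.le hb1).mul_left a).neg
  have hs := Real.summable_log_one_add_of_summable this
  simp only [← sub_eq_add_neg] at hs
  rw [qPochInf, ← Real.rexp_tsum_eq_tprod hpos hs]
  exact Real.exp_pos _

/-! ### `q`-binomial coefficients -/

theorem qBracket_pos {q : ℝ} (hq0 : 0 < q) (hq1 : q < 1) {a : ℕ} (ha : a ≠ 0) :
    0 < qBracket q a := by
  have h1 : q < q⁻¹ := hq1.trans ((one_lt_inv₀ hq0).2 hq1)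
  refine div_pos_of_neg_of_neg (sub_neg.2 ?_) (sub_neg.2 h1)
  exact zpow_lt_zpow_right_of_lt_one₀ hq0 hq1 (by omega)

theorem qFactorial_pos {q : ℝ} (hq0 : 0 < q) (hq1 : q < 1) (n : ℕ) : 0 < qFactorial q n :=
  Finset.prod_pos fun k _ => qBracket_pos hq0 hq1 k.succ_ne_zero

theorem qFactorial_succ (q : ℝ) (n : ℕ) :
    qFactorial q (n + 1) = qFactorial q n * qBracket q (n + 1) := by
  simp [qFactorial, Finset.prod_range_succ]

theorem qBinom_pos {q : ℝ} (hq0 : 0 < q) (hq1 : q < 1) {θ m : ℕ} (h : m ≤ θ) :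
    0 < qBinom q θ m := by
  rw [qBinom, if_pos h]
  exact div_pos (qFactorial_pos hq0 hq1 _)
    (mul_pos (qFactorial_pos hq0 hq1 _) (qFactorial_pos hq0 hq1 _))

theorem qBinom_zero {q : ℝ} (hq0 : 0 < q) (hq1 : q < 1) (θ : ℕ) : qBinom q θ 0 = 1 := by
  have := (qFactorial_pos hq0 hq1 θ).ne'
  simp only [qBinom, qFactorial] at *
  simp [this]

theorem qBinom_self {q : ℝ} (hq0 : 0 < q) (hq1 : q < 1) (θ : ℕ) : qBinom q θ θ = 1 := by
  have := (qFactorial_pos hq0 hq1 θ).ne'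
  simp only [qBinom, qFactorial] at *
  simp [this]

theorem qBinom_of_lt (q : ℝ) {θ m : ℕ} (h : θ < m) : qBinom q θ m = 0 := if_neg (by omega)

theorem qBinom_succ_mul {q : ℝ} (hq0 : 0 < q) (hq1 : q < 1) {θ m : ℕ} (h : m ≤ θ) :
    qBinom q θ (m + 1) * qBracket q (m + 1) = qBinom q θ m * qBracket q (θ - m) := by
  rcases h.lt_or_eq with h | rfl
  · rw [qBinom, qBinom, if_pos (by omega), if_pos (by omega), qFactorial_succ]
    obtain ⟨k, rfl⟩ : ∃ k, θ = m + 1 + k := ⟨θ - (m + 1), by omega⟩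
    rw [show m + 1 + k - (m + 1) = k by omega, show m + 1 + k - m = k + 1 by omega,
      qFactorial_succ q k]
    have h1 := (qFactorial_pos hq0 hq1 m).ne'
    have h2 := (qFactorial_pos hq0 hq1 k).ne'
    have h3 := (qBracket_pos hq0 hq1 m.succ_ne_zero).ne'
    have h4 := (qBracket_pos hq0 hq1 k.succ_ne_zero).ne'
    simp only [Nat.succ_eq_add_one] at h3 h4
    field_simp
  · simp [qBinom_of_lt, qBracket]

theorem qBracket_add_one {q : ℝ} (hq0 : 0 < q) {θ m : ℕ} (h : m ≤ θ) :
    qBracket q (θ + 1)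
      = q ^ ((m : ℤ) + 1) * qBracket q (θ - m) + q ^ ((m : ℤ) - θ) * qBracket q (m + 1) := by
  have hq := hq0.ne'
  rw [qBracket, qBracket, qBracket, mul_div_assoc', mul_div_assoc', ← add_div, mul_sub, mul_sub,
    ← zpow_add₀ hq, ← zpow_add₀ hq, ← zpow_add₀ hq, ← zpow_add₀ hq]
  congr 1
  push_cast [Nat.cast_sub h]
  rw [show (m : ℤ) + 1 + -((θ : ℤ) - m) = (m : ℤ) - θ + (m + 1) by ring,
    show (m : ℤ) + 1 + ((θ : ℤ) - m) = θ + 1 by ring,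
    show (m : ℤ) - θ + -((m : ℤ) + 1) = -(θ + 1) by ring]
  ring

theorem qBinom_pascal {q : ℝ} (hq0 : 0 < q) (hq1 : q < 1) {θ m : ℕ} (h : m ≤ θ) :
    qBinom q (θ + 1) (m + 1)
      = q ^ ((m : ℤ) + 1) * qBinom q θ (m + 1) + q ^ ((m : ℤ) - θ) * qBinom q θ m := by
  have h3 := (qBracket_pos hq0 hq1 m.succ_ne_zero).ne'
  have h1 := (qFactorial_pos hq0 hq1 m).ne'
  have h2 := (qFactorial_pos hq0 hq1 (θ - m)).ne'
  have hb := qBinom_succ_mul hq0 hq1 h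
  refine mul_right_cancel₀ h3 ?_
  have e : qBinom q (θ + 1) (m + 1) * qBracket q (m + 1) = qBinom q θ m * qBracket q (θ + 1) := by
    rw [qBinom, qBinom, if_pos (by omega), if_pos h, qFactorial_succ, qFactorial_succ,
      Nat.add_sub_add_right]
    simp only [Nat.succ_eq_add_one] at h3
    field_simp
  simp only [Nat.succ_eq_add_one]
  rw [e, qBracket_add_one hq0 h]
  linear_combination -q ^ ((m : ℤ) + 1) * hb

/-! ### The one-site weight: total mass, orthogonality and norms. -/

/-- The one-site factor, with fugacity `β`, of the weight `ω_α`. -/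
def siteWeight (q β : ℝ) (θ x : ℕ) : ℝ :=
  β ^ x * qBinom q θ x * q ^ ((x : ℤ) * ((x : ℤ) - 1))
    * qPochInf (β * q ^ (1 + 2 * (x : ℤ) - θ)) (q ^ 2)

/-- Induction on θ for all β at once. Pascal's rule splits the weight for θ + 1 into F (x + 1) + G
x; peeling one factor off the infinite product in F x makes F x + G x collapse to the weight for θ
at fugacity βq. -/
theorem sum_siteWeight {q : ℝ} (hq0 : 0 < q) (hq1 : q < 1) (θ : ℕ) (β : ℝ) :
    ∑ x ∈ Finset.range (θ + 1), siteWeight q β θ x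
      = qPochInf (β * q ^ (1 + (θ : ℤ))) (q ^ 2) := by
  have hq := hq0.ne'
  have hb0 : 0 < q ^ 2 := by positivity
  have hb1 : q ^ 2 < 1 := pow_lt_one₀ hq0.le hq1 two_ne_zero
  induction θ generalizing β with
  | zero => simp [siteWeight, qBinom_self hq0 hq1]
  | succ θ ih =>
    have e1 : ∀ x : ℕ, q ^ (((x + 1 : ℕ) : ℤ) * (((x + 1 : ℕ) : ℤ) - 1))
        = q ^ ((x : ℤ) * ((x : ℤ) - 1)) * q ^ (2 * (x : ℤ)) := by
      intro x; rw [← zpow_add₀ hq]; congr 1; push_cast; ring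
    let F : ℕ → ℝ := fun x => β ^ x * (q ^ (x : ℤ) * qBinom q θ x)
      * q ^ ((x : ℤ) * ((x : ℤ) - 1)) * qPochInf (β * q ^ (2 * (x : ℤ) - θ)) (q ^ 2)
    let G : ℕ → ℝ := fun x => β ^ (x + 1) * (q ^ ((x : ℤ) - θ) * qBinom q θ x)
      * (q ^ ((x : ℤ) * ((x : ℤ) - 1)) * q ^ (2 * (x : ℤ)))
      * qPochInf (β * q ^ (2 + 2 * (x : ℤ) - θ)) (q ^ 2)
    have h0 : siteWeight q β (θ + 1) 0 = F 0 := by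
      simp only [siteWeight, F, qBinom_zero hq0 hq1]
      congr 3
      · simp
      · push_cast; congr 1; ring
    have hs : ∀ x ∈ Finset.range (θ + 1), siteWeight q β (θ + 1) (x + 1) = F (x + 1) + G x := by
      intro x hx
      simp only [siteWeight, F, G]
      rw [qBinom_pascal hq0 hq1 (Nat.lt_succ_iff.1 (Finset.mem_range.1 hx)), e1,
        show (1 + 2 * ((x + 1 : ℕ) : ℤ) - ((θ + 1 : ℕ) : ℤ)) = 2 + 2 * (x : ℤ) - θ by
          push_cast; ring,
        show 2 * ((x + 1 : ℕ) : ℤ) - (θ : ℤ) = 2 + 2 * (x : ℤ) - θ by push_cast; ring]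
      push_cast
      ring
    have hF : F (θ + 1) = 0 := by simp [F, qBinom_of_lt]
    rw [Finset.sum_range_succ', h0, Finset.sum_congr rfl hs, Finset.sum_add_distrib, add_right_comm,
      ← Finset.sum_range_succ' F, Finset.sum_range_succ F, hF, add_zero, ← Finset.sum_add_distrib,
      show β * q ^ (1 + ((θ + 1 : ℕ) : ℤ)) = β * q * q ^ (1 + (θ : ℤ)) by
        rw [mul_assoc, ← zpow_one_add₀ hq]; congr 2; push_cast; ring,
      ← ih (β * q)]
    refine Finset.sum_congr rfl fun x _ => ?_
    simp only [F, G, siteWeight]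
    rw [qPochInf_eq (β * q ^ (2 * (x : ℤ) - θ)) hb0 hb1,
      show β * q ^ (2 * (x : ℤ) - θ) * q ^ 2 = β * q ^ (2 + 2 * (x : ℤ) - θ) by
        rw [mul_assoc, ← zpow_natCast q 2, ← zpow_add₀ hq]; congr 2; push_cast; ring,
      show β * q * q ^ (1 + 2 * (x : ℤ) - θ) = β * q ^ (2 + 2 * (x : ℤ) - θ) by
        rw [mul_assoc, ← zpow_one_add₀ hq]; congr 2; ring,
      show q ^ (2 * (x : ℤ) - θ) = q ^ (2 * (x : ℤ)) * q ^ (-(θ : ℤ)) by rw [← zpow_add₀ hq]; rfl,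
      show q ^ ((x : ℤ) - θ) = q ^ (x : ℤ) * q ^ (-(θ : ℤ)) by rw [← zpow_add₀ hq]; rfl]
    simp only [zpow_natCast, mul_pow]
    ring

theorem qBinom_succ_mul_sub {q : ℝ} (hq0 : 0 < q) (hq1 : q < 1) {θ m : ℕ} (h : m ≤ θ) :
    qBinom q θ (m + 1) * (q ^ m * q - (q ^ m * q)⁻¹)
      = qBinom q θ m * (q ^ θ / q ^ m - q ^ m / q ^ θ) := by
  have hq := hq0.ne'
  have hne : q - q⁻¹ ≠ 0 := (sub_neg.2 (hq1.trans ((one_lt_inv₀ hq0).2 hq1))).ne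
  have := qBinom_succ_mul hq0 hq1 h
  rw [qBracket, qBracket, mul_div_assoc', mul_div_assoc', div_left_inj' hne] at this
  rw [Nat.cast_sub h, neg_sub, zpow_sub₀ hq, zpow_sub₀ hq, zpow_neg] at this
  simpa only [zpow_natCast, pow_succ] using this

/-- This makes the second-order operator of `truncPhi_eigen` symmetric. The factor p - C / A at x +
1 is p times the first factor 1 - β q^(1+2x-θ) of the infinite product at x. -/
theorem siteWeight_succ {q β : ℝ} (hq0 : 0 < q) (hq1 : q < 1) (hβ : β ≠ 0) {θ x : ℕ}
    (hx : x ≤ θ) :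
    siteWeight q β θ x * ((q ^ 2) * (1 - (q ^ 2) ^ (-(θ : ℤ)) / (q ^ 2) ^ (-(x : ℤ)))
        / (q ^ 2) ^ (-(x : ℤ)))
      = siteWeight q β θ (x + 1)
        * ((β⁻¹ * q / q ^ θ - (q ^ 2) ^ (-(θ : ℤ)) / (q ^ 2) ^ (-((x + 1 : ℕ) : ℤ)))
          * (1 - (q ^ 2) ^ (-((x + 1 : ℕ) : ℤ))) / (q ^ 2) ^ (-((x + 1 : ℕ) : ℤ))) := by
  have hq := hq0.ne'
  have hb0 : 0 < q ^ 2 := by positivity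
  have hb1 : q ^ 2 < 1 := pow_lt_one₀ hq0.le hq1 two_ne_zero
  have h := qBinom_succ_mul_sub hq0 hq1 hx
  have e1 : q ^ (1 + 2 * (x : ℤ) - θ) = q * (q ^ x) ^ 2 / q ^ θ := by
    rw [zpow_sub₀ hq, zpow_add₀ hq, mul_comm 2, zpow_mul]
    simp only [zpow_natCast, zpow_one]
    norm_cast
  have e2 : q ^ (1 + 2 * ((x + 1 : ℕ) : ℤ) - θ) = q ^ (1 + 2 * (x : ℤ) - θ) * q ^ 2 := by
    rw [← zpow_natCast q 2, ← zpow_add₀ hq]; congr 1; push_cast; ring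
  have e3 : q ^ (((x + 1 : ℕ) : ℤ) * (((x + 1 : ℕ) : ℤ) - 1))
      = q ^ ((x : ℤ) * ((x : ℤ) - 1)) * (q ^ x) ^ 2 := by
    rw [← pow_mul, ← zpow_natCast q (x * 2), ← zpow_add₀ hq]; congr 1; push_cast; ring
  have e4 : ∀ n : ℕ, (q ^ 2) ^ (-(n : ℤ)) = ((q ^ n) ^ 2)⁻¹ := by
    intro n; rw [zpow_neg, zpow_natCast, ← pow_mul, ← pow_mul, mul_comm]
  simp only [siteWeight]
  rw [qPochInf_eq (β * q ^ (1 + 2 * (x : ℤ) - θ)) hb0 hb1, e2, e3, ← mul_assoc β]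
  generalize qPochInf (β * q ^ (1 + 2 * (x : ℤ) - θ) * q ^ 2) (q ^ 2) = P
  generalize q ^ ((x : ℤ) * ((x : ℤ) - 1)) = Q
  rw [e1, e4, e4, e4, pow_succ q x, pow_succ β x]
  have hX := pow_ne_zero x hq
  have hT := pow_ne_zero θ hq
  generalize q ^ x = X at *
  generalize q ^ θ = T at *
  generalize qBinom q θ x = m at *
  generalize qBinom q θ (x + 1) = m' at *
  field_simp at h ⊢
  linear_combination -Q * (T - X ^ 2 * q * β) * P * h

/-- The `q`-Krawtchouk polynomial of one site of fugacity `β`. -/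
def siteKrawtchouk (q β : ℝ) (θ n x : ℕ) : ℝ :=
  truncPhi (q ^ 2) θ ((q ^ 2) ^ (-(x : ℤ))) ((q ^ 2) ^ (-(n : ℤ)))
    (β⁻¹ * q / q ^ θ * (q ^ 2) ^ n)

theorem sum_siteWeight_mul_eq_zero {q β : ℝ} (hq0 : 0 < q) (hq1 : q < 1) (hβ : β ≠ 0)
    {θ m n : ℕ} (hm : m ≤ θ) (hn : n ≤ θ) (hmn : m ≠ n) :
    ∑ x ∈ Finset.range (θ + 1), siteWeight q β θ x *
      (siteKrawtchouk q β θ m x * siteKrawtchouk q β θ n x) = 0 := by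
  have hq := hq0.ne'
  have hb0 : 0 < q ^ 2 := by positivity
  have hb1 : q ^ 2 < 1 := pow_lt_one₀ hq0.le hq1 two_ne_zero
  have hb := hb0.ne'
  have hp : β⁻¹ * q / q ^ θ ≠ 0 := by positivity
  have hz : ∀ n : ℕ, β⁻¹ * q / q ^ θ * (q ^ 2) ^ n * (q ^ 2) ^ (-(n : ℤ)) = β⁻¹ * q / q ^ θ := by
    intro n
    rw [zpow_neg, zpow_natCast, mul_assoc, mul_inv_cancel₀ (pow_ne_zero _ hb), mul_one]
  refine sum_mul_eq_zero_of_eigen (z := β⁻¹ * q / q ^ θ * (q ^ 2) ^ m)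
    (z' := β⁻¹ * q / q ^ θ * (q ^ 2) ^ n) ?_
    (fun x _ => truncPhi_eigen hb0 hb1 θ (zpow_ne_zero _ hb) (zpow_neg_ne_self hb0 hb1 x)
      (qPoch_zpow_neg_eq_zero hb0 hm) (hz m))
    (fun x _ => truncPhi_eigen hb0 hb1 θ (zpow_ne_zero _ hb) (zpow_neg_ne_self hb0 hb1 x)
      (qPoch_zpow_neg_eq_zero hb0 hn) (hz n))
    (fun x => by rw [siteKrawtchouk, zpow_neg_succ hb])
    (fun x => by rw [siteKrawtchouk, zpow_neg_succ hb])
    (fun x => by rw [siteKrawtchouk, zpow_neg_succ hb, div_mul_cancel₀ _ hb])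
    (fun x => by rw [siteKrawtchouk, zpow_neg_succ hb, div_mul_cancel₀ _ hb])
    (by simp) (by simp [siteWeight, qBinom_of_lt])
    (fun x hx => siteWeight_succ hq0 hq1 hβ hx)
  intro h
  exact hmn (pow_right_injective₀ hb0 hb1.ne (mul_left_cancel₀ hp h))

theorem siteKrawtchouk_zero (q β : ℝ) (θ x : ℕ) : siteKrawtchouk q β θ 0 x = 1 := by
  rw [siteKrawtchouk, truncPhi_comm]
  simp [truncPhi_one_left]

/-- At n = 0 the index n - 1 is 0 instead of -1, which is harmless because 1 - (q²)^(-n) vanishes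
there. -/
theorem siteKrawtchouk_recurrence {q : ℝ} (hq0 : 0 < q) (hq1 : q < 1) (β : ℝ) {θ x : ℕ}
    (hx : x ≤ θ) (n : ℕ) :
    β⁻¹ * q / q ^ θ * (q ^ 2) ^ n / (q ^ 2) ^ (-(n : ℤ))
        * ((q ^ 2) ^ (-(x : ℤ)) * siteKrawtchouk q β θ n x)
      = (1 - (q ^ 2) ^ (-(θ : ℤ)) / (q ^ 2) ^ (-(n : ℤ))) * siteKrawtchouk q β θ (n + 1) x
        - q ^ 2 / (q ^ 2) ^ (-(n : ℤ)) * (1 - β⁻¹ * q / q ^ θ * (q ^ 2) ^ n / q ^ 2)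
          * (1 - (q ^ 2) ^ (-(n : ℤ))) * siteKrawtchouk q β θ (n - 1) x
        + ((q ^ 2 + (q ^ 2) ^ (-(θ : ℤ))) / (q ^ 2) ^ (-(n : ℤ)) - q ^ 2 - 1
          + β⁻¹ * q / q ^ θ * (q ^ 2) ^ n) * siteKrawtchouk q β θ n x := by
  have hb0 : 0 < q ^ 2 := by positivity
  have hb1 : q ^ 2 < 1 := pow_lt_one₀ hq0.le hq1 two_ne_zero
  have hb := hb0.ne'
  have h := truncPhi_recurrence hb0 hb1 θ (z := β⁻¹ * q / q ^ θ * (q ^ 2) ^ n)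
    (zpow_ne_zero (-(n : ℤ)) hb) (zpow_neg_ne_self hb0 hb1 n) (qPoch_zpow_neg_eq_zero hb0 hx)
  have h1 : siteKrawtchouk q β θ (n + 1) x = truncPhi (q ^ 2) θ ((q ^ 2) ^ (-(x : ℤ)))
      ((q ^ 2) ^ (-(n : ℤ)) / q ^ 2) (q ^ 2 * (β⁻¹ * q / q ^ θ * (q ^ 2) ^ n)) := by
    rw [siteKrawtchouk, zpow_neg_succ hb, pow_succ]; congr 1; ring
  rcases n with _ | n
  · rw [h1]; simpa [siteKrawtchouk] using h
  · have h2 : siteKrawtchouk q β θ (n + 1 - 1) x = truncPhi (q ^ 2) θ ((q ^ 2) ^ (-(x : ℤ)))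
        ((q ^ 2) ^ (-((n + 1 : ℕ) : ℤ)) * q ^ 2)
        (β⁻¹ * q / q ^ θ * (q ^ 2) ^ (n + 1) / q ^ 2) := by
      rw [siteKrawtchouk, zpow_neg_succ hb, div_mul_cancel₀ _ hb, pow_succ (q ^ 2), ← mul_assoc,
        mul_div_cancel_right₀ _ hb, Nat.add_sub_cancel]
    rw [h1, h2]
    exact h

/-- Multiplication by q^(-2x) is symmetric. Evaluating its matrix element between degrees n and n +
1 by the recurrence in either degree, and discarding orthogonal terms, relates the two norms. -/
theorem siteKrawtchouk_norm_succ {q β : ℝ} (hq0 : 0 < q) (hq1 : q < 1) (hβ : β ≠ 0)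
    {θ n : ℕ} (hn : n < θ) :
    ((q ^ 2) ^ (-(n : ℤ)) - (q ^ 2) ^ (-(θ : ℤ))) * ∑ x ∈ Finset.range (θ + 1),
        siteWeight q β θ x * (siteKrawtchouk q β θ (n + 1) x * siteKrawtchouk q β θ (n + 1) x)
      = (β⁻¹ * q / q ^ θ * (q ^ 2) ^ n - 1) * (1 - (q ^ 2) ^ (-((n + 1 : ℕ) : ℤ)))
        * ∑ x ∈ Finset.range (θ + 1),
          siteWeight q β θ x * (siteKrawtchouk q β θ n x * siteKrawtchouk q β θ n x) := by
  have hq := hq0.ne'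
  have hb0 : 0 < q ^ 2 := by positivity
  have hb := hb0.ne'
  let S : ℕ → ℕ → ℝ := fun i j => ∑ x ∈ Finset.range (θ + 1),
    siteWeight q β θ x * (siteKrawtchouk q β θ i x * siteKrawtchouk q β θ j x)
  let T : ℕ → ℕ → ℝ := fun i j => ∑ x ∈ Finset.range (θ + 1), siteWeight q β θ x *
    ((q ^ 2) ^ (-(x : ℤ)) * siteKrawtchouk q β θ i x * siteKrawtchouk q β θ j x)
  have hS : ∀ {i j}, i ≤ θ → j ≤ θ → i ≠ j → S i j = 0 :=
    fun hi hj hij => sum_siteWeight_mul_eq_zero hq0 hq1 hβ hi hj hij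
  have hrec : ∀ i j : ℕ, β⁻¹ * q / q ^ θ * (q ^ 2) ^ i / (q ^ 2) ^ (-(i : ℤ)) * T i j
      = (1 - (q ^ 2) ^ (-(θ : ℤ)) / (q ^ 2) ^ (-(i : ℤ))) * S (i + 1) j
        - q ^ 2 / (q ^ 2) ^ (-(i : ℤ)) * (1 - β⁻¹ * q / q ^ θ * (q ^ 2) ^ i / q ^ 2)
          * (1 - (q ^ 2) ^ (-(i : ℤ))) * S (i - 1) j
        + ((q ^ 2 + (q ^ 2) ^ (-(θ : ℤ))) / (q ^ 2) ^ (-(i : ℤ)) - q ^ 2 - 1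
          + β⁻¹ * q / q ^ θ * (q ^ 2) ^ i) * S i j := by
    intro i j
    simp only [S, T, Finset.mul_sum, ← Finset.sum_sub_distrib, ← Finset.sum_add_distrib]
    refine Finset.sum_congr rfl fun x hx => ?_
    linear_combination siteWeight q β θ x * siteKrawtchouk q β θ j x *
      siteKrawtchouk_recurrence hq0 hq1 β (Nat.lt_succ_iff.1 (Finset.mem_range.1 hx)) i
  have hT : T (n + 1) n = T n (n + 1) :=
    Finset.sum_congr rfl fun x _ => by ring
  have h1 := hrec n (n + 1)
  have h2 := hrec (n + 1) n
  -- Degree n + 2 may exceed θ, where orthogonality is not available; but then n + 1 = θ and the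
  -- coefficient is zero.
  have h3 : (1 - (q ^ 2) ^ (-(θ : ℤ)) / (q ^ 2) ^ (-((n + 1 : ℕ) : ℤ))) * S (n + 1 + 1) n = 0 := by
    rcases (show n + 1 ≤ θ by omega).lt_or_eq with h | h
    · rw [hS (by omega) (by omega) (by omega), mul_zero]
    · rw [h, div_self (zpow_ne_zero _ hb), sub_self, zero_mul]
  rw [hS (i := n - 1) (by omega) (by omega) (by omega), hS (i := n) (by omega) (by omega) (by omega),
    mul_zero, mul_zero, sub_zero, add_zero] at h1
  rw [h3, hS (i := n + 1) (j := n) (by omega) (by omega) (by omega), mul_zero, add_zero, zero_sub,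
    Nat.add_sub_cancel, hT] at h2
  change _ * S (n + 1) (n + 1) = _ * S n n
  rw [zpow_neg_succ hb, pow_succ (q ^ 2)] at h2
  rw [zpow_neg_succ hb]
  have hB := zpow_ne_zero (-(n : ℤ)) hb
  generalize S (n + 1) (n + 1) = s at *
  generalize S n n = s' at *
  generalize T n (n + 1) = t at *
  generalize (q ^ 2) ^ (-(n : ℤ)) = B at *
  generalize (q ^ 2) ^ (-(θ : ℤ)) = C at *
  generalize (q ^ 2) ^ n = b at *
  generalize β⁻¹ * q / q ^ θ = p at *
  field_simp at h1 h2 ⊢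
  linear_combination h2 - q ^ 2 * h1

theorem siteKrawtchouk_norm {q β : ℝ} (hq0 : 0 < q) (hq1 : q < 1) (hβ : β ≠ 0)
    {θ n : ℕ} (hn : n ≤ θ) :
    ∑ x ∈ Finset.range (θ + 1),
        siteWeight q β θ x * (siteKrawtchouk q β θ n x * siteKrawtchouk q β θ n x)
      = q ^ ((n : ℤ) * ((n : ℤ) - 1)) * qPochInf (β * q ^ (1 + (θ : ℤ) - 2 * (n : ℤ))) (q ^ 2)
        / (β ^ n * qBinom q θ n) := by
  have hq := hq0.ne'
  have hb0 : 0 < q ^ 2 := by positivity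
  have hb1 : q ^ 2 < 1 := pow_lt_one₀ hq0.le hq1 two_ne_zero
  induction n with
  | zero =>
    simp only [siteKrawtchouk_zero, mul_one, sum_siteWeight hq0 hq1, qBinom_zero hq0 hq1]
    simp
  | succ n ih =>
    have h := siteKrawtchouk_norm_succ hq0 hq1 hβ hn
    rw [ih (by omega)] at h
    have h' := qBinom_succ_mul_sub hq0 hq1 (show n ≤ θ by omega)
    have hm := (qBinom_pos hq0 hq1 (show n ≤ θ by omega)).ne'
    have hm' := (qBinom_pos hq0 hq1 hn).ne'
    have e1 : q ^ (1 + (θ : ℤ) - 2 * ((n + 1 : ℕ) : ℤ)) = q ^ θ / (q * (q ^ n) ^ 2) := by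
      rw [show 1 + (θ : ℤ) - 2 * ((n + 1 : ℕ) : ℤ) = θ - (1 + n * 2) by push_cast; ring,
        zpow_sub₀ hq, zpow_add₀ hq, zpow_mul]
      simp only [zpow_natCast, zpow_one]
      norm_cast
    have e2 : q ^ (1 + (θ : ℤ) - 2 * (n : ℤ)) = q ^ θ / (q * (q ^ n) ^ 2) * q ^ 2 := by
      rw [← e1, ← zpow_natCast q 2, ← zpow_add₀ hq]; congr 1; push_cast; ring
    have e3 : q ^ (((n + 1 : ℕ) : ℤ) * (((n + 1 : ℕ) : ℤ) - 1))
        = q ^ ((n : ℤ) * ((n : ℤ) - 1)) * (q ^ n) ^ 2 := by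
      rw [← pow_mul, ← zpow_natCast q (n * 2), ← zpow_add₀ hq]; congr 1; push_cast; ring
    have e4 : ∀ n : ℕ, (q ^ 2) ^ (-(n : ℤ)) = ((q ^ n) ^ 2)⁻¹ := by
      intro n; rw [zpow_neg, zpow_natCast, ← pow_mul, ← pow_mul, mul_comm]
    have hX := pow_pos hq0 n
    have hT := pow_pos hq0 θ
    -- Nonvanishing of q^(-2n) - q^(-2θ) up to a factor, so that the norm of degree n + 1 can be
    -- solved for.
    have hTX : (q ^ θ) ^ 2 - (q ^ n) ^ 2 ≠ 0 := by
      have h1 : q ^ θ < q ^ n := pow_lt_pow_right_of_lt_one₀ hq0 hq1 hn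
      have : 0 < (q ^ n - q ^ θ) * (q ^ n + q ^ θ) := mul_pos (sub_pos.2 h1) (add_pos hX hT)
      nlinarith
    have e5 : (q ^ 2) ^ n = (q ^ n) ^ 2 := by rw [← pow_mul, ← pow_mul, mul_comm]
    rw [e1, e3, qPochInf_eq _ hb0 hb1, mul_assoc β, ← e2]
    rw [e4, e4, e4, e5, pow_succ q n] at h
    rw [pow_succ β]
    generalize qPochInf (β * q ^ (1 + (θ : ℤ) - 2 * (n : ℤ))) (q ^ 2) = P at *
    generalize q ^ ((n : ℤ) * ((n : ℤ) - 1)) = Q at *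
    generalize (∑ x ∈ Finset.range (θ + 1),
        siteWeight q β θ x * (siteKrawtchouk q β θ (n + 1) x * siteKrawtchouk q β θ (n + 1) x))
      = s at *
    have hX := hX.ne'
    have hT := hT.ne'
    generalize q ^ n = X at *
    generalize q ^ θ = T at *
    generalize qBinom q θ n = m at *
    generalize qBinom q θ (n + 1) = m' at *
    have hβn := pow_ne_zero n hβ
    generalize β ^ n = β' at *
    field_simp at h h' ⊢
    refine mul_left_cancel₀ (mul_ne_zero (mul_ne_zero hTX hq) hm) ?_
    linear_combination m' * h + (X ^ 2 * q - T * β) * Q * P * h'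

theorem site_orthogonality {q β : ℝ} (hq0 : 0 < q) (hq1 : q < 1) (hβ : β ≠ 0)
    {θ m n : ℕ} (hm : m ≤ θ) (hn : n ≤ θ) :
    ∑ x ∈ Finset.range (θ + 1),
        siteWeight q β θ x * (siteKrawtchouk q β θ m x * siteKrawtchouk q β θ n x)
      = if m = n then
          q ^ ((n : ℤ) * ((n : ℤ) - 1)) * qPochInf (β * q ^ (1 + (θ : ℤ) - 2 * (n : ℤ))) (q ^ 2)
            / (β ^ n * qBinom q θ n)
        else 0 := by
  split_ifs with h
  · rw [h, siteKrawtchouk_norm hq0 hq1 hβ hn]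
  · exact sum_siteWeight_mul_eq_zero hq0 hq1 hβ hm hn h

/-! ### Orthogonality of the nested products -/

/-- For k > θ the denominator (q^(-2θ); q²)_k is 0 and division by zero gives 0, so the infinite sum
stops at θ. -/
theorem qKrawtchouk_eq {q : ℝ} (hq0 : 0 < q) (n x θ : ℕ) (p : ℝ) :
    qKrawtchouk n (q ^ (-2 * (x : ℤ))) p θ (q ^ 2)
      = truncPhi (q ^ 2) θ ((q ^ 2) ^ (-(x : ℤ))) ((q ^ 2) ^ (-(n : ℤ))) (p * (q ^ 2) ^ (n + 1)) := by
  have hb : q ^ 2 ≠ 0 := by positivity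
  have e : q ^ (-2 * (x : ℤ)) = (q ^ 2) ^ (-(x : ℤ)) := by
    rw [← zpow_natCast q 2, ← zpow_mul]; congr 1; push_cast; ring
  rw [qKrawtchouk, phi21, truncPhi, e]
  refine tsum_eq_sum fun k hk => ?_
  rw [qPoch_eq_zero (a := (q ^ 2) ^ (-(θ : ℤ))) (k := θ), div_zero, zero_mul]
  · simpa using hk
  · rw [zpow_neg, zpow_natCast, inv_mul_cancel₀ (pow_ne_zero _ hb)]

/-- The configuration on `L + 1` sites with `a` particles on the last site. -/
def snoc (y : Config L θ) (a : Fin (θ + 1)) : Config (L + 1) θ :=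
  Fin.snoc (α := fun _ => Fin (θ + 1)) y a

@[simp] theorem snoc_castSucc (y : Config L θ) (a : Fin (θ + 1)) (i : Fin L) :
    snoc y a i.castSucc = y i := by simp [snoc]

@[simp] theorem snoc_last (y : Config L θ) (a : Fin (θ + 1)) : snoc y a (Fin.last L) = a := by
  simp [snoc]

theorem exists_eq_snoc (x : Config (L + 1) θ) : ∃ y a, x = snoc y a :=
  ⟨Fin.init x, x (Fin.last L), (Fin.snoc_init_self x).symm⟩

theorem snoc_inj {y y' : Config L θ} {a a' : Fin (θ + 1)} :
    snoc y a = snoc y' a' ↔ y = y' ∧ a = a' := Fin.snoc_inj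

theorem sum_config_succ (f : Config (L + 1) θ → ℝ) :
    ∑ x, f x = ∑ y : Config L θ, ∑ a : Fin (θ + 1), f (snoc y a) := by
  rw [← (Fin.snocEquiv fun _ : Fin (L + 1) => Fin (θ + 1)).sum_comp, Fintype.sum_prod_type_right]
  rfl

theorem leftMass_eq (x : Config L θ) (i : Fin L) :
    leftMass x i = ∑ m, if m < i then (x m : ℕ) else 0 := by
  rw [leftMass, ← Finset.sum_filter]; congr 1; ext; simp

theorem rightMass_eq (x : Config L θ) (i : Fin L) :
    rightMass x i = ∑ m, if i < m then (x m : ℕ) else 0 := by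
  rw [rightMass, ← Finset.sum_filter]; congr 1; ext; simp

theorem mass_snoc (y : Config L θ) (a : Fin (θ + 1)) : mass (snoc y a) = mass y + a := by
  simp [mass, Fin.sum_univ_castSucc]

theorem leftMass_snoc_castSucc (y : Config L θ) (a : Fin (θ + 1)) (i : Fin L) :
    leftMass (snoc y a) i.castSucc = leftMass y i := by
  simp [leftMass_eq, Fin.sum_univ_castSucc, (Fin.castSucc_lt_last i).not_gt]

theorem leftMass_snoc_last (y : Config L θ) (a : Fin (θ + 1)) :
    leftMass (snoc y a) (Fin.last L) = mass y := by
  simp [leftMass_eq, mass, Fin.sum_univ_castSucc, Fin.castSucc_lt_last]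

theorem rightMass_snoc_castSucc (y : Config L θ) (a : Fin (θ + 1)) (i : Fin L) :
    rightMass (snoc y a) i.castSucc = rightMass y i + a := by
  simp [rightMass_eq, Fin.sum_univ_castSucc, Fin.castSucc_lt_last]

theorem rightMass_snoc_last (y : Config L θ) (a : Fin (θ + 1)) :
    rightMass (snoc y a) (Fin.last L) = 0 := by
  simp [rightMass_eq, (Fin.le_last _).not_gt]

theorem mu_snoc (q α : ℝ) (y : Config L θ) (a : Fin (θ + 1)) :
    mu q α (snoc y a) = mu q α y * (α ^ (a : ℕ) * qBinom q θ a
      * q ^ (-2 * (θ : ℤ) * ((L : ℕ) + 1) * (a : ℕ))) := by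
  simp [mu, Fin.prod_univ_castSucc]

theorem mu_mul_zpow (q α : ℝ) (c : ℤ) (x : Config L θ) :
    mu q (α * q ^ c) x = mu q α x * q ^ (c * (mass x : ℤ)) := by
  have : q ^ (c * (mass x : ℤ)) = ∏ i, (q ^ c) ^ (x i : ℕ) := by
    rw [Finset.prod_pow_eq_pow_sum, ← zpow_natCast, ← zpow_mul, mass]
  rw [this, mu, mu, ← Finset.prod_mul_distrib]
  refine Finset.prod_congr rfl fun i _ => ?_
  rw [mul_pow]; ring

theorem mu_pos {q : ℝ} (hq0 : 0 < q) (hq1 : q < 1) {α : ℝ} (hα : 0 < α) (x : Config L θ) :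
    0 < mu q α x :=
  Finset.prod_pos fun i _ => by
    have := qBinom_pos hq0 hq1 (Nat.lt_succ_iff.1 (x i).isLt)
    positivity

/-- The first L sites see the last one only through the right mass of n, absorbed by α ↦ α q^(-2c);
the last site sees the others only through the mass of z, absorbed by its fugacity. -/
theorem dualityFunction_snoc {q : ℝ} (hq0 : 0 < q) {α : ℝ} (z n : Config L θ)
    (a c : Fin (θ + 1)) :
    dualityFunction q α (snoc z a) (snoc n c)
      = dualityFunction q (α * q ^ (-2 * (c : ℤ))) z n
        * siteKrawtchouk q (α * q ^ (2 * (mass z : ℤ) - 2 * (θ : ℤ) * (L + 1))) θ c a := by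
  have hq := hq0.ne'
  rw [dualityFunction, Fin.prod_univ_castSucc, dualityFunction]
  congr 1
  · refine Finset.prod_congr rfl fun i _ => ?_
    simp only [snoc_castSucc]
    congr 1
    rw [param, param, leftMass_snoc_castSucc, rightMass_snoc_castSucc, one_div, one_div, mul_inv,
      mul_assoc, ← zpow_neg, ← zpow_add₀ hq]
    congr 2
    push_cast [Fin.val_castSucc]
    ring
  · rw [qKrawtchouk_eq hq0, snoc_last, snoc_last, siteKrawtchouk]
    congr 1
    rw [param, leftMass_snoc_last, rightMass_snoc_last, one_div, mul_inv, pow_succ' (q ^ 2),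
      ← mul_assoc]
    congr 1
    rw [← zpow_neg, ← zpow_natCast q θ, ← zpow_natCast q 2, div_eq_mul_inv, ← zpow_neg,
      mul_assoc α⁻¹, mul_assoc α⁻¹, mul_assoc α⁻¹, ← zpow_add₀ hq, ← zpow_add_one₀ hq,
      ← zpow_add₀ hq]
    congr 2
    push_cast [Fin.val_last]
    ring

/-- The cross term q^(2 N(z) a) of q^(N(N-1)) goes into the fugacity of the last site, which becomes
the one in `dualityFunction_snoc`. -/
theorem omegaWeight_snoc {q : ℝ} (hq0 : 0 < q) (α : ℝ) (z : Config L θ) (a : Fin (θ + 1)) :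
    omegaWeight q α (snoc z a)
      = mu q α z * q ^ ((mass z : ℤ) * ((mass z : ℤ) - 1))
        * siteWeight q (α * q ^ (2 * (mass z : ℤ) - 2 * (θ : ℤ) * (L + 1))) θ a := by
  have hq := hq0.ne'
  rw [omegaWeight, mu_snoc, mass_snoc, siteWeight, mul_pow, mul_assoc α, ← zpow_add₀ hq,
    ← zpow_natCast (q ^ (2 * (mass z : ℤ) - 2 * (θ : ℤ) * (L + 1))), ← zpow_mul]
  have e1 : 2 * (mass z : ℤ) - 2 * (θ : ℤ) * (L + 1) + (1 + 2 * (a : ℕ) - θ)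
      = 1 + 2 * ((mass z + a : ℕ) : ℤ) - θ * (2 * ((L + 1 : ℕ) : ℤ) + 1) := by
    push_cast; ring
  have e2 : q ^ (-2 * (θ : ℤ) * ((L : ℕ) + 1) * (a : ℕ))
        * q ^ (((mass z + a : ℕ) : ℤ) * (((mass z + a : ℕ) : ℤ) - 1))
      = q ^ ((mass z : ℤ) * ((mass z : ℤ) - 1)) * (q ^ (((a : ℕ) : ℤ) * (((a : ℕ) : ℤ) - 1))
        * q ^ ((2 * (mass z : ℤ) - 2 * (θ : ℤ) * (L + 1)) * (a : ℕ))) := by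
    rw [← zpow_add₀ hq, ← zpow_add₀ hq, ← zpow_add₀ hq]; congr 1; push_cast; ring
  rw [e1]
  linear_combination (mu q α z * α ^ (a : ℕ) * qBinom q θ a *
    qPochInf (α * q ^ (1 + 2 * ((mass z + a : ℕ) : ℤ) - θ * (2 * ((L + 1 : ℕ) : ℤ) + 1)))
      (q ^ 2)) * e2

/-- Induction on L with α varying, because summing out the last site changes α to α q^(-2c). -/
theorem sum_omegaWeight_mul {q : ℝ} (hq0 : 0 < q) (hq1 : q < 1) {α : ℝ} (hα : 0 < α)
    (x n : Config L θ) :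
    ∑ z, omegaWeight q α z * (dualityFunction q α z x * dualityFunction q α z n)
      = if x = n then q ^ ((mass n : ℤ) * ((mass n : ℤ) - 1))
          * qPochInf (α * q ^ (1 - 2 * (mass n : ℤ) - (θ : ℤ))) (q ^ 2) / mu q α n
        else 0 := by
  have hq := hq0.ne'
  induction L generalizing α with
  | zero =>
    rw [if_pos (Subsingleton.elim x n)]
    simp [omegaWeight, mu, dualityFunction, mass]
  | succ L ih =>
    obtain ⟨x, a, rfl⟩ := exists_eq_snoc x
    obtain ⟨n, c, rfl⟩ := exists_eq_snoc n
    have hin : ∀ z : Config L θ, ∑ s : Fin (θ + 1), omegaWeight q α (snoc z s)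
        * (dualityFunction q α (snoc z s) (snoc x a) * dualityFunction q α (snoc z s) (snoc n c))
        = if a = c then q ^ (((c : ℕ) : ℤ) * (((c : ℕ) : ℤ) - 1))
            / (α ^ (c : ℕ) * qBinom q θ c * q ^ (-2 * (θ : ℤ) * ((L : ℕ) + 1) * (c : ℕ)))
            * (omegaWeight q (α * q ^ (-2 * (c : ℤ))) z
              * (dualityFunction q (α * q ^ (-2 * (c : ℤ))) z x
                * dualityFunction q (α * q ^ (-2 * (c : ℤ))) z n))
          else 0 := by
      intro z
      set β := α * q ^ (2 * (mass z : ℤ) - 2 * (θ : ℤ) * (L + 1)) with hβ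
      have hβ0 : β ≠ 0 := mul_ne_zero hα.ne' (zpow_ne_zero _ hq)
      have := site_orthogonality hq0 hq1 hβ0 (Nat.lt_succ_iff.1 a.isLt) (Nat.lt_succ_iff.1 c.isLt)
      rw [← Fin.sum_univ_eq_sum_range (fun s => siteWeight q β θ s *
        (siteKrawtchouk q β θ a s * siteKrawtchouk q β θ c s))] at this
      calc _ = mu q α z * q ^ ((mass z : ℤ) * ((mass z : ℤ) - 1))
            * (dualityFunction q (α * q ^ (-2 * (a : ℤ))) z x
                * dualityFunction q (α * q ^ (-2 * (c : ℤ))) z n)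
            * ∑ s : Fin (θ + 1), siteWeight q β θ s *
              (siteKrawtchouk q β θ a s * siteKrawtchouk q β θ c s) := by
            rw [Finset.mul_sum]
            refine Finset.sum_congr rfl fun s _ => ?_
            rw [omegaWeight_snoc hq0, dualityFunction_snoc hq0, dualityFunction_snoc hq0]
            ring
        _ = _ := by
            rw [this]
            by_cases hac : a = c
            · subst hac
              rw [if_pos rfl, if_pos rfl, omegaWeight, mu_mul_zpow]
              -- The infinite product in the one-site norm is exactly the one in the weight of z on
              -- L sites at parameter α q^(-2a).
              have e1 : β * q ^ (1 + (θ : ℤ) - 2 * ((a : ℕ) : ℤ)) = α * q ^ (-2 * (a : ℤ))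
                  * q ^ (1 + 2 * (mass z : ℤ) - (θ : ℤ) * (2 * (L : ℤ) + 1)) := by
                rw [hβ, mul_assoc α, mul_assoc α, ← zpow_add₀ hq, ← zpow_add₀ hq]; congr 2; ring
              have e2 : β ^ (a : ℕ) = α ^ (a : ℕ) * q ^ (-2 * (θ : ℤ) * ((L : ℕ) + 1) * (a : ℕ))
                  * (q ^ (-2 * (a : ℤ) * (mass z : ℤ)))⁻¹ := by
                rw [hβ, mul_pow, ← zpow_natCast (q ^ _), ← zpow_mul, ← zpow_neg,
                  mul_assoc (α ^ (a : ℕ)), ← zpow_add₀ hq]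
                congr 2; ring
              rw [e1, e2]
              field_simp
            · rw [if_neg hac, if_neg (fun h => hac (Fin.ext h)), mul_zero]
    rw [sum_config_succ, Finset.sum_congr rfl fun z _ => hin z]
    by_cases hac : a = c
    · subst hac
      simp only [if_true, ← Finset.mul_sum]
      rw [ih (by positivity), mass_snoc, mu_snoc, mu_mul_zpow]
      by_cases hxn : x = n
      · subst hxn
        rw [if_pos rfl, if_pos rfl]
        have e1 : α * q ^ (-2 * (a : ℤ)) * q ^ (1 - 2 * (mass x : ℤ) - θ)
            = α * q ^ (1 - 2 * ((mass x + a : ℕ) : ℤ) - θ) := by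
          rw [mul_assoc, ← zpow_add₀ hq]; congr 2; push_cast; ring
        have e2 : q ^ (((mass x + a : ℕ) : ℤ) * (((mass x + a : ℕ) : ℤ) - 1))
            = q ^ ((a : ℤ) * ((a : ℤ) - 1)) * q ^ ((mass x : ℤ) * ((mass x : ℤ) - 1))
              * (q ^ (-2 * (a : ℤ) * (mass x : ℤ)))⁻¹ := by
          rw [← zpow_neg, ← zpow_add₀ hq, ← zpow_add₀ hq]; congr 1; push_cast; ring
        rw [e1, e2]
        field_simp
      · rw [if_neg hxn, if_neg (fun h => hxn (snoc_inj.1 h).1), mul_zero]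
    · simp only [hac, if_false, Finset.sum_const_zero]
      rw [if_neg (fun h => hac (snoc_inj.1 h).2)]

/-! ### Self-duality of the generator -/

/-- Two configurations that differ only on the bond `{i, j}`, with the same number of particles
on this bond. -/
def BondEquiv (i j : Fin L) (x y : Config L θ) : Prop :=
  (∀ k, k ≠ i → k ≠ j → y k = x k) ∧ (y i : ℕ) + y j = x i + x j

theorem BondEquiv.refl (i j : Fin L) (x : Config L θ) : BondEquiv i j x x :=
  ⟨fun _ _ _ => rfl, rfl⟩

/-- Exchanging particles on the bond is invisible to a sum over a set that contains both endpoints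
or neither. -/
theorem BondEquiv.sum_eq {i j : Fin L} (hij : i ≠ j) {x y : Config L θ} (h : BondEquiv i j x y)
    {s : Finset (Fin L)} (hs : i ∈ s ↔ j ∈ s) : ∑ k ∈ s, (y k : ℕ) = ∑ k ∈ s, (x k : ℕ) := by
  by_cases hi : i ∈ s
  · have hj : j ∈ s.erase i := Finset.mem_erase.2 ⟨hij.symm, hs.1 hi⟩
    rw [← Finset.add_sum_erase s _ hi, ← Finset.add_sum_erase _ _ hj,
      ← Finset.add_sum_erase s (fun k => (x k : ℕ)) hi, ← Finset.add_sum_erase _ _ hj,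
      ← add_assoc, ← add_assoc, h.2]
    congr 1
    refine Finset.sum_congr rfl fun k hk => ?_
    simp only [Finset.mem_erase] at hk
    rw [h.1 k hk.2.1 hk.1]
  · refine Finset.sum_congr rfl fun k hk => ?_
    rw [h.1 k (fun e => hi (e ▸ hk)) (fun e => hi (hs.2 (e ▸ hk)))]

theorem move_left {x : Config L θ} (i j : Fin L) : (move x i j i : ℕ) = x i - 1 := by simp [move]

theorem move_right {x : Config L θ} {i j : Fin L} (hij : i ≠ j) (hj : (x j : ℕ) < θ) :
    (move x i j j : ℕ) = x j + 1 := by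
  simp [move, hij.symm]; omega

theorem move_of_ne {x : Config L θ} {i j k : Fin L} (hi : k ≠ i) (hj : k ≠ j) :
    move x i j k = x k := by simp [move, hi, hj]

theorem bondEquiv_move {x : Config L θ} {i j : Fin L} (hij : i ≠ j) (hi : 0 < (x i : ℕ))
    (hj : (x j : ℕ) < θ) : BondEquiv i j x (move x i j) :=
  ⟨fun _ h h' => move_of_ne h h', by rw [move_left, move_right hij hj]; omega⟩

theorem bondEquiv_move' {x : Config L θ} {i j : Fin L} (hij : i ≠ j) (hi : (x i : ℕ) < θ)
    (hj : 0 < (x j : ℕ)) : BondEquiv i j x (move x j i) :=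
  ⟨fun _ h h' => move_of_ne h' h, by rw [move_left, move_right hij.symm hi]; omega⟩

/-- Both jump rates share the constant q / (1 - q²)²; the rest matches the coefficients of
`bondAction`. -/
theorem rate_right {q : ℝ} (hq0 : 0 < q) (hq1 : q < 1) (a c : ℕ) :
    q ^ (-2 * (θ : ℤ) + 1) * qNum (q ^ (2 : ℤ)) a * qNum (q ^ (2 : ℤ)) ((θ : ℤ) - c)
      = q / (1 - q ^ 2) ^ 2 * ((q ^ 2) ^ (-(c : ℤ)) / (q ^ 2) ^ (-(a : ℤ))
        * (1 - (q ^ 2) ^ (-(a : ℤ))) * (1 - (q ^ 2) ^ (-(θ : ℤ)) / (q ^ 2) ^ (-(c : ℤ)))) := by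
  have hq := hq0.ne'
  have hb : q ^ 2 ≠ 0 := by positivity
  have hb1 : 1 - q ^ 2 ≠ 0 := (sub_pos.2 (pow_lt_one₀ hq0.le hq1 two_ne_zero)).ne'
  have e : q ^ (-2 * (θ : ℤ) + 1) = (q ^ 2) ^ (-(θ : ℤ)) * q := by
    rw [zpow_add_one₀ hq, ← zpow_natCast q 2, ← zpow_mul]; congr 2; push_cast; ring
  rw [e, qNum, qNum, show q ^ (2 : ℤ) = q ^ 2 from by norm_cast, zpow_sub₀ hb]
  simp only [zpow_neg, zpow_natCast]
  field_simp
  ring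

theorem rate_left {q : ℝ} (hq0 : 0 < q) (hq1 : q < 1) (a c : ℕ) :
    q ^ (2 * (θ : ℤ) - 1) * qNum (q ^ (-2 : ℤ)) c * qNum (q ^ (-2 : ℤ)) ((θ : ℤ) - a)
      = q / (1 - q ^ 2) ^ 2 * (q ^ 2 / (q ^ 2) ^ (-(θ : ℤ))
        * (1 - (q ^ 2) ^ (-(c : ℤ))) * (1 - (q ^ 2) ^ (-(θ : ℤ)) / (q ^ 2) ^ (-(a : ℤ)))) := by
  have hq := hq0.ne'
  have hb : q ^ 2 ≠ 0 := by positivity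
  have hb1 : 1 - q ^ 2 ≠ 0 := (sub_pos.2 (pow_lt_one₀ hq0.le hq1 two_ne_zero)).ne'
  have e : q ^ (2 * (θ : ℤ) - 1) = ((q ^ 2) ^ (-(θ : ℤ)))⁻¹ / q := by
    rw [zpow_sub_one₀ hq, ← zpow_neg, neg_neg, ← zpow_natCast q 2, ← zpow_mul, div_eq_mul_inv]
    norm_cast
  have e2 : 1 - (q ^ 2)⁻¹ = -(1 - q ^ 2) / q ^ 2 := by field_simp; ring
  rw [e, qNum, qNum, show q ^ (-2 : ℤ) = (q ^ 2)⁻¹ from by norm_cast, zpow_sub₀ (inv_ne_zero hb), e2]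
  simp only [zpow_neg, zpow_natCast, inv_pow]
  field_simp

/-- The bond generator in terms of the variables `q ^ (-2 x_i)`, `q ^ (-2 x_j)`. -/
theorem bondGenerator_eq {q : ℝ} (hq0 : 0 < q) (hq1 : q < 1) {i j : Fin L} (hij : i ≠ j)
    (f : Config L θ → ℝ) (x : Config L θ) (R : ℝ) (Φ : ℝ → ℝ → ℝ)
    (hf : ∀ y, BondEquiv i j x y →
      f y = R * Φ ((q ^ 2) ^ (-((y i : ℕ) : ℤ))) ((q ^ 2) ^ (-((y j : ℕ) : ℤ))))
    {A₁ A₂ : ℝ} (hA₁ : A₁ = (q ^ 2) ^ (-((x i : ℕ) : ℤ))) (hA₂ : A₂ = (q ^ 2) ^ (-((x j : ℕ) : ℤ))) :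
    bondGenerator q i j f x = q / (1 - q ^ 2) ^ 2 * R
      * (A₂ / A₁ * (1 - A₁) * (1 - (q ^ 2) ^ (-(θ : ℤ)) / A₂)
          * (Φ (A₁ * q ^ 2) (A₂ / q ^ 2) - Φ A₁ A₂)
        + q ^ 2 / (q ^ 2) ^ (-(θ : ℤ)) * (1 - A₂) * (1 - (q ^ 2) ^ (-(θ : ℤ)) / A₁)
          * (Φ (A₁ / q ^ 2) (A₂ * q ^ 2) - Φ A₁ A₂)) := by
  have hb : q ^ 2 ≠ 0 := by positivity
  have hpred : ∀ {m : ℕ}, 0 < m → (q ^ 2) ^ (-((m - 1 : ℕ) : ℤ)) = (q ^ 2) ^ (-(m : ℤ)) * q ^ 2 := by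
    intro m hm
    obtain ⟨m, rfl⟩ := Nat.exists_eq_add_one.2 hm
    rw [zpow_neg_succ hb, div_mul_cancel₀ _ hb, Nat.add_sub_cancel]
  have h0 := hf x (BondEquiv.refl i j x)
  rw [← hA₁, ← hA₂] at h0
  change _ * (f (move x i j) - f x) + _ * (f (move x j i) - f x) = _
  rw [rate_right hq0 hq1, rate_left hq0 hq1, ← hA₁, ← hA₂, h0, mul_add]
  congr 1
  -- For a forbidden jump the rate factor 1 - A₁ (empty departure site) or 1 - C / A₂ (full target
  -- site) is zero, so neither the value of `move` nor that of Φ matters.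
  · by_cases hi : (x i : ℕ) = 0
    · have : A₁ = 1 := by rw [hA₁, hi]; simp
      simp [this]
    by_cases hj : (x j : ℕ) = θ
    · have : (q ^ 2) ^ (-(θ : ℤ)) / A₂ = 1 := by rw [hA₂, hj, div_self (zpow_ne_zero _ hb)]
      rw [this]; ring
    have hi' := Nat.pos_of_ne_zero hi
    have hj' : (x j : ℕ) < θ := by omega
    rw [hf _ (bondEquiv_move hij hi' hj'), move_left, move_right hij hj', hpred hi',
      zpow_neg_succ hb, ← hA₁, ← hA₂]
    ring
  · by_cases hj : (x j : ℕ) = 0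
    · have : A₂ = 1 := by rw [hA₂, hj]; simp
      simp [this]
    by_cases hi : (x i : ℕ) = θ
    · have : (q ^ 2) ^ (-(θ : ℤ)) / A₁ = 1 := by rw [hA₁, hi, div_self (zpow_ne_zero _ hb)]
      rw [this]; ring
    have hj' := Nat.pos_of_ne_zero hj
    have hi' : (x i : ℕ) < θ := by omega
    rw [hf _ (bondEquiv_move' hij hi' hj'), move_left, move_right hij.symm hi', hpred hj',
      zpow_neg_succ hb, ← hA₁, ← hA₂]
    ring

/-- The argument of the basic hypergeometric series at site `k`. -/
def siteArg (q α : ℝ) (x n : Config L θ) (k : Fin L) : ℝ :=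
  1 / α * q ^ (-2 * ((∑ m ∈ Finset.Iio k, (x m : ℕ) : ℕ) : ℤ)
    + 2 * ((∑ m ∈ Finset.Ici k, (n m : ℕ) : ℕ) : ℤ) + (θ : ℤ) * (2 * (k : ℕ) + 1) + 1)

theorem siteArg_eq {q : ℝ} (hq0 : 0 < q) (α : ℝ) (x n : Config L θ) (k : Fin L) :
    param q α x n k * (q ^ 2) ^ ((n k : ℕ) + 1) = siteArg q α x n k := by
  rw [param, siteArg, mul_assoc, ← pow_mul, ← zpow_natCast, ← zpow_add₀ hq0.ne', leftMass,
    rightMass, ← Finset.Ioi_insert, Finset.sum_insert (by simp)]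
  congr 2
  push_cast
  ring

/-- The factor at site `k` of the duality function. -/
def siteFactor (q α : ℝ) (x n : Config L θ) (k : Fin L) : ℝ :=
  truncPhi (q ^ 2) θ ((q ^ 2) ^ (-((x k : ℕ) : ℤ))) ((q ^ 2) ^ (-((n k : ℕ) : ℤ)))
    (siteArg q α x n k)

theorem dualityFunction_eq {q : ℝ} (hq0 : 0 < q) (α : ℝ) (x n : Config L θ) :
    dualityFunction q α x n = ∏ k, siteFactor q α x n k := by
  rw [dualityFunction]
  refine Finset.prod_congr rfl fun k _ => ?_
  rw [qKrawtchouk_eq hq0, siteArg_eq hq0, siteFactor]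

/-- The sets `Iio k` and `Ici k` separate i from j = i + 1 only when k = j. -/
theorem siteArg_congr (q α : ℝ) {i j : Fin L} (hj : (j : ℕ) = i + 1) {x y n m : Config L θ}
    (hy : BondEquiv i j x y) (hm : BondEquiv i j n m) {k : Fin L} (hk : k ≠ j) :
    siteArg q α y m k = siteArg q α x n k := by
  have hij : i ≠ j := by rintro rfl; omega
  have hk' : (k : ℕ) ≠ i + 1 := fun h => hk (Fin.ext (h.trans hj.symm))
  rw [siteArg, siteArg, hy.sum_eq hij, hm.sum_eq hij]
  · simp only [Finset.mem_Ici, Fin.le_def]; omega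
  · simp only [Finset.mem_Iio, Fin.lt_def]; omega

/-- Passing from i to j adds x i to the left sum and removes n i from the right one; this yields the
relation between w and z required in `bondAction_comm`. -/
theorem siteArg_succ {q : ℝ} (hq0 : 0 < q) (α : ℝ) {i j : Fin L} (hj : (j : ℕ) = i + 1)
    (x n : Config L θ) :
    siteArg q α x n j = siteArg q α x n i * (q ^ 2) ^ (-((x i : ℕ) : ℤ))
      * (q ^ 2) ^ (-((n i : ℕ) : ℤ)) / (q ^ 2) ^ (-(θ : ℤ)) := by
  have hq := hq0.ne'
  have h1 : Finset.Iio j = insert i (Finset.Iio i) := by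
    ext k; simp only [Finset.mem_Iio, Finset.mem_insert, Fin.lt_def, Fin.ext_iff]; omega
  have h2 : Finset.Ici i = insert i (Finset.Ici j) := by
    ext k; simp only [Finset.mem_Ici, Finset.mem_insert, Fin.le_def, Fin.ext_iff]; omega
  have h3 : i ∉ Finset.Ici j := by simp only [Finset.mem_Ici, Fin.le_def]; omega
  rw [siteArg, siteArg, h1, h2, Finset.sum_insert (by simp), Finset.sum_insert h3, hj,
    ← zpow_natCast q 2, ← zpow_mul, ← zpow_mul, ← zpow_mul, mul_assoc (1 / α), mul_assoc (1 / α),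
    mul_div_assoc, ← zpow_add₀ hq, ← zpow_add₀ hq, ← zpow_sub₀ hq]
  congr 2
  push_cast
  ring

theorem dualityFunction_bond {q : ℝ} (hq0 : 0 < q) (α : ℝ) {i j : Fin L} (hj : (j : ℕ) = i + 1)
    {x y n m : Config L θ} (hy : BondEquiv i j x y) (hm : BondEquiv i j n m) :
    dualityFunction q α y m
      = (∏ k ∈ (Finset.univ.erase i).erase j, siteFactor q α x n k)
        * (truncPhi (q ^ 2) θ ((q ^ 2) ^ (-((y i : ℕ) : ℤ))) ((q ^ 2) ^ (-((m i : ℕ) : ℤ)))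
            (siteArg q α x n i)
          * truncPhi (q ^ 2) θ ((q ^ 2) ^ (-((y j : ℕ) : ℤ))) ((q ^ 2) ^ (-((m j : ℕ) : ℤ)))
            (siteArg q α x n i * (q ^ 2) ^ (-((y i : ℕ) : ℤ))
              * (q ^ 2) ^ (-((m i : ℕ) : ℤ)) / (q ^ 2) ^ (-(θ : ℤ)))) := by
  have hij : i ≠ j := by rintro rfl; omega
  rw [dualityFunction_eq hq0, ← Finset.mul_prod_erase _ _ (Finset.mem_univ i),
    ← Finset.mul_prod_erase _ _ (Finset.mem_erase.2 ⟨hij.symm, Finset.mem_univ j⟩),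
    ← siteArg_congr q α hj hy hm hij, ← siteArg_succ hq0 α hj, ← mul_assoc, mul_comm]
  congr 1
  refine Finset.prod_congr rfl fun k hk => ?_
  simp only [Finset.mem_erase] at hk
  rw [siteFactor, siteFactor, siteArg_congr q α hj hy hm hk.1, hy.1 k hk.2.1 hk.1,
    hm.1 k hk.2.1 hk.1]

theorem bondGenerator_dualityFunction {q : ℝ} (hq0 : 0 < q) (hq1 : q < 1) (α : ℝ) {i j : Fin L}
    (hj : (j : ℕ) = i + 1) (x n : Config L θ) :
    bondGenerator q i j (fun y => dualityFunction q α y n) x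
      = bondGenerator q i j (fun m => dualityFunction q α x m) n := by
  have hij : i ≠ j := by rintro rfl; omega
  have hb0 : 0 < q ^ 2 := by positivity
  have hb1 : q ^ 2 < 1 := pow_lt_one₀ hq0.le hq1 two_ne_zero
  have hb := hb0.ne'
  have hle : ∀ a : Fin (θ + 1), (a : ℕ) ≤ θ := fun a => Nat.lt_succ_iff.1 a.isLt
  obtain ⟨A₁, hA₁⟩ : ∃ A, A = (q ^ 2) ^ (-((x i : ℕ) : ℤ)) := ⟨_, rfl⟩
  obtain ⟨A₂, hA₂⟩ : ∃ A, A = (q ^ 2) ^ (-((x j : ℕ) : ℤ)) := ⟨_, rfl⟩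
  obtain ⟨B₁, hB₁⟩ : ∃ A, A = (q ^ 2) ^ (-((n i : ℕ) : ℤ)) := ⟨_, rfl⟩
  obtain ⟨B₂, hB₂⟩ : ∃ A, A = (q ^ 2) ^ (-((n j : ℕ) : ℤ)) := ⟨_, rfl⟩
  have hcomm := bondAction_comm hb0 hb1 θ (A₁ := A₁) (A₂ := A₂) (B₁ := B₁) (B₂ := B₂)
    (z := siteArg q α x n i) (hA₁ ▸ zpow_ne_zero _ hb) (hA₂ ▸ zpow_ne_zero _ hb)
    (hA₁ ▸ zpow_neg_ne_self hb0 hb1 _) (hA₂ ▸ zpow_neg_ne_self hb0 hb1 _)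
    (hB₁ ▸ zpow_ne_zero _ hb) (hB₂ ▸ zpow_ne_zero _ hb)
    (hB₁ ▸ zpow_neg_ne_self hb0 hb1 _) (hB₂ ▸ zpow_neg_ne_self hb0 hb1 _)
    (hA₁ ▸ qPoch_zpow_neg_eq_zero hb0 (hle _)) (hA₂ ▸ qPoch_zpow_neg_eq_zero hb0 (hle _))
    (hB₁ ▸ qPoch_zpow_neg_eq_zero hb0 (hle _)) (hB₂ ▸ qPoch_zpow_neg_eq_zero hb0 (hle _)) rfl
  rw [bondGenerator_eq hq0 hq1 hij _ x
      (∏ k ∈ (Finset.univ.erase i).erase j, siteFactor q α x n k)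
      (fun a a' => truncPhi (q ^ 2) θ a B₁ (siteArg q α x n i)
        * truncPhi (q ^ 2) θ a' B₂ (siteArg q α x n i * a * B₁ / (q ^ 2) ^ (-(θ : ℤ))))
      (fun y hy => by
        rw [dualityFunction_bond hq0 α hj hy (BondEquiv.refl i j n), hB₁, hB₂]) hA₁ hA₂,
    bondGenerator_eq hq0 hq1 hij _ n
      (∏ k ∈ (Finset.univ.erase i).erase j, siteFactor q α x n k)
      (fun a a' => truncPhi (q ^ 2) θ a A₁ (siteArg q α x n i)
        * truncPhi (q ^ 2) θ a' A₂ (siteArg q α x n i * a * A₁ / (q ^ 2) ^ (-(θ : ℤ))))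
      (fun m hm => by
        rw [dualityFunction_bond hq0 α hj (BondEquiv.refl i j x) hm, hA₁, hA₂]
        -- Symmetry of the series lets n play the role of the moving configuration.
        simp only [truncPhi_comm (q ^ 2) θ ((q ^ 2) ^ (-((m _ : ℕ) : ℤ)))]
        rw [mul_right_comm (siteArg q α x n i)]) hB₁ hB₂]
  congr 1
  simp only [bondAction] at hcomm
  have e : ∀ u v c : ℝ, c * (u * q ^ 2) * v / (q ^ 2) ^ (-(θ : ℤ))
      = q ^ 2 * (c * u * v / (q ^ 2) ^ (-(θ : ℤ))) := fun u v c => by ring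
  have e' : ∀ u v c : ℝ, c * (u / q ^ 2) * v / (q ^ 2) ^ (-(θ : ℤ))
      = c * u * v / (q ^ 2) ^ (-(θ : ℤ)) / q ^ 2 := fun u v c => by ring
  simp only [e, e']
  rw [hcomm, mul_right_comm (siteArg q α x n i) B₁ A₁]

theorem generator_dualityFunction {q : ℝ} (hq0 : 0 < q) (hq1 : q < 1) (α : ℝ)
    (x n : Config L θ) :
    generator L θ q (fun y => dualityFunction q α y n) x
      = generator L θ q (fun m => dualityFunction q α x m) n := by
  simp only [generator, LinearMap.sum_apply, Finset.sum_apply]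
  refine Finset.sum_congr rfl fun i _ => Finset.sum_congr rfl fun j _ => ?_
  split_ifs with h
  · exact bondGenerator_dualityFunction hq0 hq1 α h x n
  · rfl

/-! ### Detailed balance -/

theorem move_move {x : Config L θ} {i j : Fin L} (hij : i ≠ j) (hi : 0 < (x i : ℕ))
    (hj : (x j : ℕ) < θ) : move (move x i j) j i = x := by
  have hi' : (move x i j i : ℕ) < θ := by rw [move_left]; have := (x i).isLt; omega
  funext k
  refine Fin.ext ?_
  by_cases h : k = i
  · subst h; rw [move_right hij.symm hi', move_left]; omega
  by_cases h' : k = j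
  · subst h'; rw [move_left, move_right hij hj]; omega
  rw [move_of_ne h' h, move_of_ne h h']

/-- The factor at site `k` of the weight `μ_α`. -/
def muFactor (q α : ℝ) (θ k a : ℕ) : ℝ :=
  α ^ a * qBinom q θ a * q ^ (-2 * (θ : ℤ) * (k + 1) * a)

/-- Two-site detailed balance. The q-binomial ratios give the occupation dependence, and the
site-dependent powers of q differ by q^(2θ) between neighbours, which offsets the asymmetry of the
rates. -/
theorem muFactor_rate {q : ℝ} (hq0 : 0 < q) (hq1 : q < 1) (α : ℝ) {a c : ℕ} (ha : a ≤ θ)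
    (hc : c ≤ θ) (k : ℕ) :
    muFactor q α θ k (a + 1) * muFactor q α θ (k + 1) c
        * (q ^ (-2 * (θ : ℤ) + 1) * qNum (q ^ (2 : ℤ)) (a + 1 : ℕ)
          * qNum (q ^ (2 : ℤ)) ((θ : ℤ) - c))
      = muFactor q α θ k a * muFactor q α θ (k + 1) (c + 1)
        * (q ^ (2 * (θ : ℤ) - 1) * qNum (q ^ (-2 : ℤ)) (c + 1 : ℕ)
          * qNum (q ^ (-2 : ℤ)) ((θ : ℤ) - a)) := by
  have hq := hq0.ne'
  have hb : q ^ 2 ≠ 0 := by positivity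
  have h1 := qBinom_succ_mul_sub hq0 hq1 ha
  have h2 := qBinom_succ_mul_sub hq0 hq1 hc
  have hb1 : 1 - q ^ 2 ≠ 0 := (sub_pos.2 (pow_lt_one₀ hq0.le hq1 two_ne_zero)).ne'
  have e4 : ∀ n : ℕ, (q ^ 2) ^ (-(n : ℤ)) = ((q ^ n) ^ 2)⁻¹ := by
    intro n; rw [zpow_neg, zpow_natCast, ← pow_mul, ← pow_mul, mul_comm]
  have e5 : q ^ (-2 * (θ : ℤ) * ((k : ℤ) + 1) * ((a + 1 : ℕ) : ℤ))
        * q ^ (-2 * (θ : ℤ) * (((k + 1 : ℕ) : ℤ) + 1) * (c : ℤ))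
      = q ^ (-2 * (θ : ℤ) * ((k : ℤ) + 1) * (a : ℤ))
        * q ^ (-2 * (θ : ℤ) * (((k + 1 : ℕ) : ℤ) + 1) * ((c + 1 : ℕ) : ℤ)) * (q ^ θ) ^ 2 := by
    rw [← pow_mul, ← zpow_natCast q (θ * 2), ← zpow_add₀ hq, ← zpow_add₀ hq, ← zpow_add₀ hq]
    congr 1; push_cast; ring
  rw [rate_right hq0 hq1, rate_left hq0 hq1, zpow_neg_succ hb, zpow_neg_succ hb]
  simp only [muFactor, e4, pow_succ α]
  generalize q ^ (-2 * (θ : ℤ) * ((k : ℤ) + 1) * ((a + 1 : ℕ) : ℤ)) = Q₁ at *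
  generalize q ^ (-2 * (θ : ℤ) * (((k + 1 : ℕ) : ℤ) + 1) * (c : ℤ)) = Q₂ at *
  generalize q ^ (-2 * (θ : ℤ) * ((k : ℤ) + 1) * (a : ℤ)) = Q₃ at *
  generalize q ^ (-2 * (θ : ℤ) * (((k + 1 : ℕ) : ℤ) + 1) * ((c + 1 : ℕ) : ℤ)) = Q₄ at *
  have hX := pow_ne_zero a hq
  have hY := pow_ne_zero c hq
  have hT := pow_ne_zero θ hq
  generalize q ^ a = X at *
  generalize q ^ c = Y at *
  generalize q ^ θ = T at *
  generalize qBinom q θ a = m at *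
  generalize qBinom q θ (a + 1) = m' at *
  generalize qBinom q θ c = s at *
  generalize qBinom q θ (c + 1) = s' at *
  field_simp at h1 h2 ⊢
  refine mul_left_cancel₀ hT ?_
  linear_combination α ^ a * α * α ^ c * (s * (T ^ 2 - Y ^ 2) * Q₁ * Q₂ * h1
    + q * m * (T ^ 2 - X ^ 2) * s * (T ^ 2 - Y ^ 2) * e5 - T ^ 2 * m * (T ^ 2 - X ^ 2) * Q₃ * Q₄ * h2)

theorem mu_bond (q α : ℝ) {i j : Fin L} (hj : (j : ℕ) = i + 1) {x y : Config L θ}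
    (hy : BondEquiv i j x y) :
    mu q α y = (∏ k ∈ (Finset.univ.erase i).erase j, muFactor q α θ k (x k))
      * (muFactor q α θ i (y i) * muFactor q α θ (i + 1) (y j)) := by
  have hij : i ≠ j := by rintro rfl; omega
  have : mu q α y = ∏ k : Fin L, muFactor q α θ k (y k) := rfl
  rw [this, ← Finset.mul_prod_erase _ _ (Finset.mem_univ i),
    ← Finset.mul_prod_erase _ _ (Finset.mem_erase.2 ⟨hij.symm, Finset.mem_univ j⟩),
    ← mul_assoc, mul_comm, hj]
  congr 1
  refine Finset.prod_congr rfl fun k hk => ?_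
  simp only [Finset.mem_erase] at hk
  rw [hy.1 k hk.2.1 hk.1]

/-- The rightward flow from x to y equals the leftward flow from y to x. A jump preserves the mass,
so the factors distinguishing ω from μ agree on both sides. -/
theorem omegaWeight_move {q : ℝ} (hq0 : 0 < q) (hq1 : q < 1) (α : ℝ) {i j : Fin L}
    (hj : (j : ℕ) = i + 1) (x y : Config L θ) :
    omegaWeight q α x * (q ^ (-2 * (θ : ℤ) + 1) * qNum (q ^ (2 : ℤ)) (x i : ℕ)
        * qNum (q ^ (2 : ℤ)) ((θ : ℤ) - (x j : ℕ)) * if move x i j = y then 1 else 0)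
      = omegaWeight q α y * (q ^ (2 * (θ : ℤ) - 1) * qNum (q ^ (-2 : ℤ)) (y j : ℕ)
        * qNum (q ^ (-2 : ℤ)) ((θ : ℤ) - (y i : ℕ)) * if move y j i = x then 1 else 0) := by
  have hij : i ≠ j := by rintro rfl; omega
  have hz : ∀ b : ℝ, qNum b 0 = 0 := fun b => by simp [qNum]
  by_cases h : 0 < (x i : ℕ) ∧ (x j : ℕ) < θ ∧ move x i j = y
  · obtain ⟨hxi, hxj, rfl⟩ := h
    have hy := bondEquiv_move hij hxi hxj
    have hm : mass (move x i j) = mass x := hy.sum_eq hij (by simp)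
    rw [if_pos rfl, if_pos (move_move hij hxi hxj), omegaWeight, omegaWeight, hm,
      mu_bond q α hj hy, mu_bond q α hj (BondEquiv.refl i j x), move_left, move_right hij hxj]
    obtain ⟨a, ha⟩ := Nat.exists_eq_add_one.2 hxi
    rw [ha, Nat.add_sub_cancel]
    have hle := Nat.lt_succ_iff.1 (x i).isLt
    linear_combination (∏ k ∈ (Finset.univ.erase i).erase j, muFactor q α θ k (x k))
      * q ^ ((mass x : ℤ) * ((mass x : ℤ) - 1))
      * qPochInf (α * q ^ (1 + 2 * (mass x : ℤ) - (θ : ℤ) * (2 * (L : ℤ) + 1))) (q ^ 2)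
      * muFactor_rate hq0 hq1 α (show a ≤ θ by omega) hxj.le i
  -- Without an admissible jump from x to y both flows are zero: either the indicator fails or the
  -- rate vanishes at an empty or full site.
  · have h1 : q ^ (-2 * (θ : ℤ) + 1) * qNum (q ^ (2 : ℤ)) (x i : ℕ)
        * qNum (q ^ (2 : ℤ)) ((θ : ℤ) - (x j : ℕ)) * (if move x i j = y then 1 else 0) = 0 := by
      split_ifs with hm
      · by_cases hi : (x i : ℕ) = 0
        · simp [hi, hz]
        · have : (x j : ℕ) = θ := by
            by_contra hne
            exact h ⟨by omega, by have := (x j).isLt; omega, hm⟩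
          simp [this, hz]
      · simp
    have h2 : q ^ (2 * (θ : ℤ) - 1) * qNum (q ^ (-2 : ℤ)) (y j : ℕ)
        * qNum (q ^ (-2 : ℤ)) ((θ : ℤ) - (y i : ℕ)) * (if move y j i = x then 1 else 0) = 0 := by
      split_ifs with hm
      · by_cases hi : (y j : ℕ) = 0
        · simp [hi, hz]
        by_cases hi' : (y i : ℕ) = θ
        · simp [hi', hz]
        have hlt : (y i : ℕ) < θ := by have := (y i).isLt; omega
        have hpos := Nat.pos_of_ne_zero hi
        subst hm
        refine absurd ⟨?_, ?_, move_move hij.symm hpos hlt⟩ h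
        · rw [move_right hij.symm hlt]; omega
        · rw [move_left]; have := (y j).isLt; omega
      · simp
    rw [h1, h2]; simp

theorem omegaWeight_bondGenerator {q : ℝ} (hq0 : 0 < q) (hq1 : q < 1) (α : ℝ) {i j : Fin L}
    (hj : (j : ℕ) = i + 1) (x y : Config L θ) :
    omegaWeight q α x * bondGenerator q i j (Pi.single y 1) x
      = omegaWeight q α y * bondGenerator q i j (Pi.single x 1) y := by
  by_cases hxy : x = y
  · rw [hxy]
  have hs : ∀ u v : Config L θ, (Pi.single u 1 : Config L θ → ℝ) v = if v = u then 1 else 0 :=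
    fun u v => Pi.single_apply u 1 v
  simp only [bondGenerator, LinearMap.coe_mk, AddHom.coe_mk, hs, if_neg hxy, if_neg (Ne.symm hxy), sub_zero]
  -- The rightward flow out of x balances the leftward flow out of y, and conversely; the second
  -- instance has the roles of x and y exchanged.
  linear_combination omegaWeight_move hq0 hq1 α hj x y - omegaWeight_move hq0 hq1 α hj y x

theorem omega_detailed_balance {q : ℝ} (hq0 : 0 < q) (hq1 : q < 1) (α : ℝ) (x y : Config L θ) :
    omega q α x * LinearMap.toMatrix' (generator L θ q) x y
      = omega q α y * LinearMap.toMatrix' (generator L θ q) y x := by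
  have h : omegaWeight q α x * generator L θ q (Pi.single y 1) x
      = omegaWeight q α y * generator L θ q (Pi.single x 1) y := by
    simp only [generator, LinearMap.sum_apply, Finset.sum_apply, Finset.mul_sum]
    refine Finset.sum_congr rfl fun i _ => Finset.sum_congr rfl fun j _ => ?_
    split_ifs with h
    · exact omegaWeight_bondGenerator hq0 hq1 α h x y
    · simp
  rw [omega, omega, LinearMap.toMatrix'_apply, LinearMap.toMatrix'_apply, div_mul_eq_mul_div,
    div_mul_eq_mul_div]
  exact congrArg (· / partition L θ q α) h

/-! ### Positivity and normalization -/

/-- The upper bound on α puts the argument of the infinite product below q^(2N) ≤ 1, making all its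
factors positive. -/
theorem omegaWeight_pos {q : ℝ} (hq0 : 0 < q) (hq1 : q < 1) {α : ℝ} (hα0 : 0 < α)
    (hα1 : α < q ^ (-1 + (2 * (L : ℤ) + 1) * (θ : ℤ))) (x : Config L θ) :
    0 < omegaWeight q α x := by
  have hb0 : 0 < q ^ 2 := by positivity
  have hb1 : q ^ 2 < 1 := pow_lt_one₀ hq0.le hq1 two_ne_zero
  refine mul_pos (mul_pos (mu_pos hq0 hq1 hα0 x) (by positivity)) (qPochInf_pos hb0 hb1 ?_)
  calc _ < q ^ (-1 + (2 * (L : ℤ) + 1) * (θ : ℤ))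
        * q ^ (1 + 2 * (mass x : ℤ) - (θ : ℤ) * (2 * (L : ℤ) + 1)) := by gcongr
    _ = q ^ (2 * mass x) := by
      rw [← zpow_add₀ hq0.ne', ← zpow_natCast]; congr 1; push_cast; ring
    _ ≤ 1 := pow_le_one₀ hq0.le hq1.le

theorem partition_pos {q : ℝ} (hq0 : 0 < q) (hq1 : q < 1) {α : ℝ} (hα0 : 0 < α)
    (hα1 : α < q ^ (-1 + (2 * (L : ℤ) + 1) * (θ : ℤ))) : 0 < partition L θ q α :=
  Finset.sum_pos (fun x _ => omegaWeight_pos hq0 hq1 hα0 hα1 x) Finset.univ_nonempty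

/-! ### Finite-state Markov processes -/

section Markov
variable {S : Type*} [Fintype S] [DecidableEq S]

theorem generator_apply_eq_sum (G : (S → ℝ) →ₗ[ℝ] (S → ℝ)) (f : S → ℝ) (x : S) :
    G f x = ∑ y, LinearMap.toMatrix' G x y * f y := by
  conv_lhs => rw [← Matrix.toLin'_toMatrix' G]
  rfl

theorem semiconjBy_matrix_exp {D A B : Matrix S S ℝ} (h : SemiconjBy D A B) :
    SemiconjBy D (NormedSpace.exp A) (NormedSpace.exp B) := by
  let _ : NormedRing (Matrix S S ℝ) := Matrix.linftyOpNormedRing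
  let _ : NormedAlgebra ℝ (Matrix S S ℝ) := Matrix.linftyOpNormedAlgebra
  let _ : NormedAlgebra ℚ (Matrix S S ℝ) := NormedAlgebra.restrictScalars ℚ ℝ _
  exact h.exp_right

/-- A duality relation for the generator extends to the transition function. -/
theorem transition_duality (G : (S → ℝ) →ₗ[ℝ] (S → ℝ)) (D : S → S → ℝ)
    (h : ∀ x n, G (fun y => D y n) x = G (fun m => D x m) n) (t : ℝ≥0) (x n : S) :
    ∑ y, transition G t x y * D y n = ∑ y, transition G t n y * D x y := by
  -- In matrix form the hypothesis is D Gᵀ = G D, an intertwining that the exponential preserves.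
  have hG : SemiconjBy (Matrix.of D) ((t : ℝ) • LinearMap.toMatrix' G).transpose
      ((t : ℝ) • LinearMap.toMatrix' G) := by
    ext x n
    have := h x n
    rw [generator_apply_eq_sum, generator_apply_eq_sum] at this
    simp only [Matrix.mul_apply, Matrix.transpose_apply, Matrix.smul_apply, Matrix.of_apply,
      smul_eq_mul]
    calc _ = (t : ℝ) * ∑ m, LinearMap.toMatrix' G n m * D x m := by
          rw [Finset.mul_sum]; exact Finset.sum_congr rfl fun _ _ => by ring
      _ = _ := by
          rw [← this, Finset.mul_sum]; exact Finset.sum_congr rfl fun _ _ => by ring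
  have := congrFun (congrFun (semiconjBy_matrix_exp hG).eq x) n
  rw [Matrix.exp_transpose] at this
  simp only [Matrix.mul_apply, Matrix.transpose_apply, Matrix.of_apply] at this
  rw [transition, ← this]
  exact Finset.sum_congr rfl fun _ _ => mul_comm _ _

theorem IsMarkovProcess.integral_eq [MeasurableSpace S] [MeasurableSingletonClass S]
    {Ω : Type*} [MeasurableSpace Ω] {G : (S → ℝ) →ₗ[ℝ] (S → ℝ)} {P : S → Measure Ω}
    {X : ℝ≥0 → Ω → S} (h : IsMarkovProcess G P X) (f : S → ℝ) (t : ℝ≥0) (x : S) :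
    ∫ ω, f (X t ω) ∂(P x) = ∑ y, transition G t x y * f y := by
  have := h.isProbabilityMeasure x
  have hm := h.measurable t
  have hp : ∀ y, (P x).real {ω | X t ω = y} = transition G t x y := by
    intro y
    -- The one-time law comes from the Markov property at time 0 with the trivial event, since the
    -- process starts at x almost surely.
    have h1 := h.markov x 0 t Set.univ MeasurableSet.univ x y
    have h2 : (P x).real (Set.univ ∩ {ω | X 0 ω = x}) = 1 := by
      rw [measureReal_congr (t := Set.univ), probReal_univ]
      refine Filter.eventuallyEq_set.2 ?_
      filter_upwards [h.start x] with ω hω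
      simp [hω]
    have h3 : (P x).real (Set.univ ∩ {ω | X 0 ω = x} ∩ {ω | X (0 + t) ω = y})
        = (P x).real {ω | X t ω = y} := by
      refine measureReal_congr (Filter.eventuallyEq_set.2 ?_)
      filter_upwards [h.start x] with ω hω
      simp [hω]
    rw [h2, h3, one_mul] at h1
    exact h1
  have : IsProbabilityMeasure ((P x).map (X t)) := Measure.isProbabilityMeasure_map hm.aemeasurable
  rw [← integral_map (φ := X t) (f := f) hm.aemeasurable (by fun_prop),
    integral_fintype (Integrable.of_finite)]
  refine Finset.sum_congr rfl fun y _ => ?_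
  rw [map_measureReal_apply hm (measurableSet_singleton y), smul_eq_mul, ← hp]
  rfl

end Markov

end ASEP

end

theorem theorem3p1 (L : ℕ) (hL : 1 ≤ L) (θ : ℕ) (q : ℝ) (hq0 : 0 < q) (hq1 : q < 1)
    (α : ℝ) (hα0 : 0 < α) (hα1 : α < q ^ (-1 + (2 * (L : ℤ) + 1) * (θ : ℤ))) :
    -- self-duality: any two copies of the process are dual with respect to `D_α`
    (∀ (Ω : Type*) [MeasurableSpace Ω] (Ω' : Type*) [MeasurableSpace Ω']
      (P : ASEP.Config L θ → Measure Ω) (X : ℝ≥0 → Ω → ASEP.Config L θ)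
      (P' : ASEP.Config L θ → Measure Ω') (X' : ℝ≥0 → Ω' → ASEP.Config L θ),
      ASEP.IsMarkovProcess (ASEP.generator L θ q) P X →
      ASEP.IsMarkovProcess (ASEP.generator L θ q) P' X' →
      ASEP.AreDual P X P' X' (ASEP.dualityFunction q α)) ∧
    -- the same relation for the transition function of the process
    (∀ (t : ℝ≥0) (x n : ASEP.Config L θ),
      ∑ y, ASEP.transition (ASEP.generator L θ q) t x y * ASEP.dualityFunction q α y n
        = ∑ y, ASEP.transition (ASEP.generator L θ q) t n y * ASEP.dualityFunction q α x y) ∧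
    -- `ω_α` is a strictly positive probability measure, reversible for the process
    (∀ x : ASEP.Config L θ, 0 < ASEP.omega q α x) ∧
    (∑ x : ASEP.Config L θ, ASEP.omega q α x = 1) ∧
    (∀ x y : ASEP.Config L θ,
      ASEP.omega q α x * LinearMap.toMatrix' (ASEP.generator L θ q) x y
        = ASEP.omega q α y * LinearMap.toMatrix' (ASEP.generator L θ q) y x) ∧
    -- orthogonality
    (∀ x n : ASEP.Config L θ,
      ∑ z, ASEP.dualityFunction q α z x * ASEP.dualityFunction q α z n * ASEP.omega q α z
        = if x = n then ASEP.g q α x / ASEP.omega q α x else 0) := by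
  have hdual := ASEP.transition_duality (ASEP.generator L θ q) (ASEP.dualityFunction q α)
    (ASEP.generator_dualityFunction hq0 hq1 α)
  have hpos := ASEP.omegaWeight_pos (L := L) (θ := θ) hq0 hq1 hα0 hα1
  have hZ := ASEP.partition_pos (L := L) (θ := θ) hq0 hq1 hα0 hα1
  refine ⟨?_, hdual, fun x => div_pos (hpos x) hZ, ?_, ASEP.omega_detailed_balance hq0 hq1 α, ?_⟩
  · intro Ω _ Ω' _ P X P' X' hX hX' x n t _
    rw [hX.integral_eq (fun y => ASEP.dualityFunction q α y n), hX'.integral_eq, hdual]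
  · simp only [ASEP.omega]
    rw [← Finset.sum_div, ← ASEP.partition, div_self hZ.ne']
  · intro x n
    have h := ASEP.sum_omegaWeight_mul hq0 hq1 hα0 x n
    calc _ = (∑ z, ASEP.omegaWeight q α z
          * (ASEP.dualityFunction q α z x * ASEP.dualityFunction q α z n))
            / ASEP.partition L θ q α := by
          rw [Finset.sum_div]
          exact Finset.sum_congr rfl fun z _ => by rw [ASEP.omega]; ring
      _ = _ := by
          rw [h]
          split_ifs with hxn
          · subst hxn
            have hx := hpos x
            rw [ASEP.g, ASEP.omega]
            -- One of the two powers q^(N(N-1)) in g, one factor 1 / Z and the first infinite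
            -- product cancel against ω, leaving the norm of `sum_omegaWeight_mul` divided by Z.
            have e : q ^ (2 * (ASEP.mass x : ℤ) * ((ASEP.mass x : ℤ) - 1))
                = q ^ ((ASEP.mass x : ℤ) * ((ASEP.mass x : ℤ) - 1))
                  * q ^ ((ASEP.mass x : ℤ) * ((ASEP.mass x : ℤ) - 1)) := by
              rw [← zpow_add₀ hq0.ne']; congr 1; ring
            rw [e]
            rw [ASEP.omegaWeight] at hx ⊢
            have h1 := left_ne_zero_of_mul (left_ne_zero_of_mul hx.ne')
            have h2 := right_ne_zero_of_mul hx.ne'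
            field_simp
          · exact zero_div _
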